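/- A dilation surface is a compact connected topological surface $X$, possibly with boundary, with a finite set $\Sigma\subset X$ of singularities and an atlas of charts on $X\setminus\Sigma$ with values in $\mathbb{C}$, such that: the transition maps are locally of the form $z\mapsto az+b$ with $a\in\mathbb{R}_{>0}$, $b\in\mathbb{C}$; each interior singularity has a neighbourhood isomorphic to a flat cone of angle $2\pi k$ (for some integer $k\ge 1$) cut along a ray and reglued by a homothety of some ratio $\rho>0$; each singularity on the boundary has a neighbourhood isomorphic to a flat cone of some angle $\alpha>0$ between two boundary geodesic rays; the boundary is a finite union of geodesic segments with endpoints in $\Sigma$, and each boundary component contains an element of $\Sigma$. It is a translation surface if $X\setminus\Sigma$ has an atlas, made of charts of the dilation structure, whose transition maps are translations. For $x_0\in X$ (possibly singular, possibly on the boundary) and an open interval $U\subset\mathbb{S}^1$, a pencil $P(x_0,U)$ is a one-parameter family of trajectories (oriented straight lines) starting from $x_0$, one in each direction of $U$: it is given by a locally affine, direction-preserving immersion into $X\setminus\Sigma$ of a small planar sector $\{re^{i\theta} : 0<r<\varepsilon,\ e^{i\theta}\in U\}$ that extends continuously to the apex by $0\mapsto x_0$, and its trajectories are the maximal straight continuations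 of the images of the rays of the sector. A closed geodesic is a closed curve in $X\setminus\Sigma$ that is locally a straight line in the charts, also at its base point; it is hyperbolic if its dilation ratio (the linear part of its affine holonomy) is different from $1$. **Lemma.** Let $X$ be a dilation surface; if $X$ is a translation surface, assume that $\Sigma\neq\emptyset$. Let $x_0\in X$, let $U\subset\mathbb{S}^1$ be a nonempty open interval, and let $P(x_0,U)$ be a pencil none of whose trajectories, after leaving $x_0$, hits a singularity or crosses the boundary of $X$. Then $X$ contains a hyperbolic closed geodesic whose direction belongs to $U$ or to $-U$. -/

import Mathlib

open Set Filter Topology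

noncomputable section

/-- A chart is modelled on `ℂ` (interior points) or on a closed half-plane (the left-hand side of a
straight line): `T` is a relatively open subset of one of these. -/
def IsFlatRegion (T : Set ℂ) : Prop :=
  IsOpen T ∨ ∃ O : Set ℂ, IsOpen O ∧ ∃ (p : ℂ) (u : Circle),
    T = O ∩ {z : ℂ | 0 ≤ ((z - p) * (starRingEnd ℂ) (u : ℂ)).im}

/-- Near `x`, the `ℂ`-valued function `g` is obtained from `f` by `z ↦ a z + b` with `a > 0`. -/
def DilationRelated {X : Type*} [TopologicalSpace X] (x : X) (f g : X → ℂ) : Prop :=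
  ∃ (a : ℝ) (b : ℂ), 0 < a ∧ ∀ᶠ y in 𝓝 x, g y = (a : ℂ) * f y + b

/-- A finite set `sing` of singularities and an atlas on its complement whose charts are
homeomorphisms onto open subsets of `ℂ` or of closed half-planes of `ℂ` and whose transition maps
are locally of the form `z ↦ a z + b` with `a > 0`. -/
structure DilationAtlas (X : Type*) [TopologicalSpace X] where
  sing : Set X
  finite_sing : sing.Finite
  charts : Set (PartialEquiv X ℂ)
  isOpen_source : ∀ e ∈ charts, IsOpen e.source
  source_subset : ∀ e ∈ charts, e.source ⊆ singᶜ
  continuousOn_chart : ∀ e ∈ charts, ContinuousOn e e.source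
  continuousOn_symm : ∀ e ∈ charts, ContinuousOn e.symm e.target
  flat_target : ∀ e ∈ charts, IsFlatRegion e.target
  cover : ∀ x ∉ sing, ∃ e ∈ charts, x ∈ e.source
  transition : ∀ e ∈ charts, ∀ f ∈ charts, ∀ x ∈ e.source ∩ f.source, DilationRelated x e f

namespace DilationAtlas

variable {X : Type*} [TopologicalSpace X]

/-- `x` is an interior conical singularity of angle `2πk` and dilation ratio `ρ`: a neighbourhood
of `x` is a flat cone of angle `2πk`, cut along a ray and glued back by a homothety of ratio `ρ`.
`E (s, θ)` is the point at angle `θ` and at distance `s ρ ^ (θ / 2πk)` from the apex `x`; so the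
point at distance `s` on the side `θ = 0` of the cut cone is the point at distance `ρ s` on the
side `θ = 2πk`. -/
def IsInteriorCone (S : DilationAtlas X) (x : X) (k : ℕ) (ρ : ℝ) : Prop :=
  0 < k ∧ 0 < ρ ∧ ∃ E : ℝ × ℝ → X,
    ContinuousOn E (Ico 0 1 ×ˢ univ) ∧ IsOpen (E '' (Ico 0 1 ×ˢ univ)) ∧
    (∀ θ : ℝ, E (0, θ) = x) ∧
    (∀ s ∈ Ico (0 : ℝ) 1, ∀ s' ∈ Ico (0 : ℝ) 1, ∀ θ θ' : ℝ,
      E (s, θ) = E (s', θ') ↔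
        (s = 0 ∧ s' = 0) ∨ (s = s' ∧ ∃ n : ℤ, θ' = θ + n * (2 * Real.pi * k))) ∧
    ∀ s ∈ Ioo (0 : ℝ) 1, ∀ θ : ℝ, ∃ e ∈ S.charts, ∃ (a : ℝ) (b : ℂ), 0 < a ∧
      E (s, θ) ∈ e.source ∧ ∀ᶠ p : ℝ × ℝ in 𝓝 (s, θ), E p ∈ e.source ∧
        e (E p) = (a : ℂ) *
          (((p.1 * ρ ^ (p.2 / (2 * Real.pi * k)) : ℝ) : ℂ) * (Circle.exp p.2 : ℂ)) + b

/-- `x` is a boundary singularity of angle `α`: a neighbourhood of `x` is a flat cone of angle `α`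
between two geodesic rays (in the directions `θ₀` and `θ₀ + α`). `E (s, θ)` is the point at
distance `s` from the apex `x` in the direction `θ`. -/
def IsBoundaryCone (S : DilationAtlas X) (x : X) (θ₀ α : ℝ) : Prop :=
  0 < α ∧ ∃ E : ℝ × ℝ → X,
    ContinuousOn E (Ico 0 1 ×ˢ Icc θ₀ (θ₀ + α)) ∧
    IsOpen (E '' (Ico 0 1 ×ˢ Icc θ₀ (θ₀ + α))) ∧
    (∀ θ ∈ Icc θ₀ (θ₀ + α), E (0, θ) = x) ∧
    (∀ s ∈ Ico (0 : ℝ) 1, ∀ s' ∈ Ico (0 : ℝ) 1,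
      ∀ θ ∈ Icc θ₀ (θ₀ + α), ∀ θ' ∈ Icc θ₀ (θ₀ + α),
      E (s, θ) = E (s', θ') ↔ (s = 0 ∧ s' = 0) ∨ (s = s' ∧ θ = θ')) ∧
    ∀ s ∈ Ioo (0 : ℝ) 1, ∀ θ ∈ Icc θ₀ (θ₀ + α), ∃ e ∈ S.charts, ∃ (a : ℝ) (b : ℂ), 0 < a ∧
      E (s, θ) ∈ e.source ∧
      ∀ᶠ p : ℝ × ℝ in 𝓝[Ico 0 1 ×ˢ Icc θ₀ (θ₀ + α)] (s, θ), E p ∈ e.source ∧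
        e (E p) = (a : ℂ) * ((p.1 : ℂ) * (Circle.exp p.2 : ℂ)) + b

/-- The boundary of the surface: regular points that a chart sends to the edge of a half-plane, and
boundary singularities. -/
def boundary (S : DilationAtlas X) : Set X :=
  {x | ∃ e ∈ S.charts, x ∈ e.source ∧ e.target ∉ 𝓝 (e x)} ∪
    {x | x ∈ S.sing ∧ ∃ θ₀ α, S.IsBoundaryCone x θ₀ α}

/-- `S` is a translation structure: the regular part has an atlas of charts belonging to the
dilation structure whose transition maps are translations. -/
def IsTranslation (S : DilationAtlas X) : Prop :=
  ∃ T : Set (PartialEquiv X ℂ),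
    (∀ e ∈ T, IsOpen e.source ∧ e.source ⊆ S.singᶜ ∧
      ∀ f ∈ S.charts, ∀ x ∈ f.source ∩ e.source, DilationRelated x f e) ∧
    (∀ x ∉ S.sing, ∃ e ∈ T, x ∈ e.source) ∧
    ∀ e ∈ T, ∀ f ∈ T, ∀ x ∈ e.source ∩ f.source, ∃ b : ℂ, ∀ᶠ y in 𝓝 x, f y = e y + b

/-- On the interval `I`, the curve `γ` stays in the regular part and is, in charts, a straight line
in direction `d`, affinely parametrized. -/
def IsStraightOn (S : DilationAtlas X) (γ : ℝ → X) (d : Circle) (I : Set ℝ) : Prop :=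
  ∀ t ∈ I, ∃ e ∈ S.charts, γ t ∈ e.source ∧ ∃ c : ℝ, 0 < c ∧
    ∀ᶠ s in 𝓝[I] t, γ s ∈ e.source ∧ e (γ s) = e (γ t) + ((c * (s - t) : ℝ) : ℂ) * (d : ℂ)

/-- A closed geodesic in direction `d`, given as a loop on `[0, 1]`. It is also straight where it
closes up, since it leaves and reaches `γ 0 = γ 1` in the same direction. -/
def IsClosedGeodesic (S : DilationAtlas X) (γ : ℝ → X) (d : Circle) : Prop :=
  γ 0 = γ 1 ∧ S.IsStraightOn γ d (Icc 0 1)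

/-- `ρ` is the dilation ratio (linear holonomy) of the loop `γ` on `[0, 1]`: `g t` is the analytic
continuation along `γ` of a local chart `g 0` at `γ 0`, and the final chart `g 1` is `ρ g 0 + b`. -/
def HasDilationRatio (S : DilationAtlas X) (γ : ℝ → X) (ρ : ℝ) : Prop :=
  ∃ g : ℝ → X → ℂ,
    (∀ t ∈ Icc (0 : ℝ) 1, ∃ e ∈ S.charts, γ t ∈ e.source ∧ DilationRelated (γ t) e (g t)) ∧
    (∀ t ∈ Icc (0 : ℝ) 1, ∀ᶠ s in 𝓝[Icc 0 1] t, ∀ᶠ y in 𝓝 (γ s), g s y = g t y) ∧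
    ∃ b : ℂ, ∀ᶠ y in 𝓝 (γ 0), g 1 y = (ρ : ℂ) * g 0 y + b

/-- A hyperbolic closed geodesic in direction `d`: its dilation ratio is nontrivial. -/
def IsHyperbolicClosedGeodesic (S : DilationAtlas X) (γ : ℝ → X) (d : Circle) : Prop :=
  S.IsClosedGeodesic γ d ∧ ∃ ρ : ℝ, S.HasDilationRatio γ ρ ∧ ρ ≠ 1

end DilationAtlas

/-- A dilation surface with boundary (compactness, the Hausdorff property and connectedness are
assumptions on `X`). The charts make the boundary geodesic away from the singularities; as each
boundary component contains a singularity, the boundary is a finite union of saddle connections. -/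
structure DilationSurface (X : Type*) [TopologicalSpace X] extends DilationAtlas X where
  cone_model : ∀ x ∈ sing, (∃ k ρ, toDilationAtlas.IsInteriorCone x k ρ) ∨
    ∃ θ₀ α, toDilationAtlas.IsBoundaryCone x θ₀ α
  sing_on_boundary : ∀ x ∈ toDilationAtlas.boundary,
    (connectedComponentIn toDilationAtlas.boundary x ∩ sing).Nonempty

/-- A (nonempty) open interval of directions. -/
def IsOpenArc (U : Set Circle) : Prop :=
  ∃ a b : ℝ, a < b ∧ b ≤ a + 2 * Real.pi ∧ U = Circle.exp '' Ioo a b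

/-- The open planar sector with apex `0`, radius `ε` and set of directions `U`. -/
def planarSector (U : Set Circle) (ε : ℝ) : Set ℂ :=
  {z | ∃ r ∈ Ioo 0 ε, ∃ u ∈ U, z = (r : ℂ) * (u : ℂ)}

namespace DilationSurface

variable {X : Type*} [TopologicalSpace X]

/-- A pencil `P(x₀, U)`: a sector of directions `U` at `x₀`, given by an immersion `φ` of a small
planar sector that is the inverse of a chart near each point and maps the apex to `x₀`. The
trajectory of direction `u ∈ U` of the pencil starts as `t ↦ φ (t u)`. If `x₀` is a regular point,
then `φ` is determined by `U` up to rescaling; if `x₀` is a singularity, the datum of `φ`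
distinguishes the different pencils with the same directions. -/
def IsPencil (S : DilationSurface X) (x₀ : X) (U : Set Circle) (φ : ℂ → X) : Prop :=
  ∃ ε : ℝ, 0 < ε ∧ Tendsto φ (𝓝[planarSector U ε] 0) (𝓝 x₀) ∧
    ∀ z ∈ planarSector U ε, ∃ e ∈ S.charts, φ z ∈ e.source ∧ ∃ c : ℝ, 0 < c ∧
      ∀ᶠ w in 𝓝 z, φ w ∈ e.source ∧ e (φ w) = e (φ z) + (c : ℂ) * (w - z)

/-- The trajectory of direction `u` of the pencil given by `x₀` and `φ` reaches `y` at some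
positive time: it is straight before that time and tends to `y`. -/
def TrajectoryReaches (S : DilationSurface X) (x₀ : X) (φ : ℂ → X) (u : Circle) (y : X) : Prop :=
  ∃ (T : ℝ) (γ : ℝ → X), 0 < T ∧ ContinuousOn γ (Icc 0 T) ∧ γ 0 = x₀ ∧
    (∀ᶠ t : ℝ in 𝓝[>] 0, γ t = φ ((t : ℂ) * (u : ℂ))) ∧
    S.IsStraightOn γ u (Ioo 0 T) ∧ γ T = y

end DilationSurface

end

open Set Filter Topology

noncomputable section

set_option linter.unusedSectionVars false

/-! Inside `U` choose a convex cone `K = openCone u δ` of directions and continue the pencil along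
the rays of `K` as far as possible. This gives a map `Φ` (`extension`) on an open set `D`
(`domain`), locally the inverse of a chart up to a dilation. The source of closed geodesics is
`isHyperbolicClosedGeodesic_segment`: if `Φ w = Φ w'` and `Φ` has scales `a ≠ a'` at `w`, `w'` in
one chart, then a segment joining them inside a convex set of immersion points maps to a closed
geodesic of ratio `a / a'`. It suffices that `w' - w ∈ K`, so the direction found lies in `U`
itself.

Suppose `D` does not contain `K` (`exists_hyperbolic_of_notMem`). A touching point `z ∉ D` is the
tip of a convex open `G ⊆ D`. The curve `Φ (t z)` cannot converge to a singularity as `t → 1`, so it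
accumulates at a regular point `y`. It cannot end inside a chart around `y` either (`notMem_ball`),
so whenever it returns near `y` the scale of `Φ` is at least of order `1 / (1 - t)`. Hence `y`
itself has preimages in `G` close to `t z` compared with `1 - t`, with scales tending to infinity.
Two of them give the geodesic.

Suppose `K ⊆ D` (`exists_hyperbolic_or_isTranslation`). At infinity `Φ` accumulates at a regular
point, because a set containing rays from every point of the plane cannot be immersed in a conical
neighbourhood. A value `y` is then taken at points tending to infinity. Either two scales differ and
there is a geodesic, or all far preimages have the same scale. In that case ever larger discs around
them have the same germ and glue to an immersion of the whole plane. Such an immersion is onto a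
translation surface without singularities (`isTranslation_of_plane`), which the hypothesis excludes.
-/

theorem IsFlatRegion.exists_radius {T : Set ℂ} (hT : IsFlatRegion T) {v : ℂ} (hv : v ∈ T) :
    ∃ r > 0, ∀ w ∈ Metric.ball v r, w ∈ closure T → w ∈ T := by
  rcases hT with hT | ⟨O, hO, p, u, rfl⟩
  · obtain ⟨r, hr, h⟩ := Metric.isOpen_iff.1 hT v hv
    exact ⟨r, hr, fun w hw _ => h hw⟩
  · obtain ⟨r, hr, h⟩ := Metric.isOpen_iff.1 hO v hv.1
    refine ⟨r, hr, fun w hw hc => ⟨h hw, ?_⟩⟩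
    -- The closed half-plane contributes no missing limit points, so near `v` the target is
    -- relatively closed. Continuation arguments can therefore be run in boundary charts as well.
    have hcl : IsClosed {z : ℂ | 0 ≤ ((z - p) * (starRingEnd ℂ) (u : ℂ)).im} :=
      isClosed_le continuous_const (by fun_prop)
    exact hcl.closure_subset_iff.2 inter_subset_right hc

theorem DilationRelated.trans {X : Type*} [TopologicalSpace X] {x : X} {f g h : X → ℂ}
    (hfg : DilationRelated x f g) (hgh : DilationRelated x g h) : DilationRelated x f h := by
  obtain ⟨a, b, ha, h₁⟩ := hfg
  obtain ⟨a', b', ha', h₂⟩ := hgh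
  refine ⟨a' * a, a' * b + b', mul_pos ha' ha, ?_⟩
  filter_upwards [h₁, h₂] with y hy hy'
  rw [hy', hy]
  push_cast
  ring

theorem DilationRelated.symm {X : Type*} [TopologicalSpace X] {x : X} {f g : X → ℂ}
    (hfg : DilationRelated x f g) : DilationRelated x g f := by
  obtain ⟨a, b, ha, h⟩ := hfg
  refine ⟨a⁻¹, -(a⁻¹ * b), inv_pos.2 ha, ?_⟩
  filter_upwards [h] with y hy
  have : (a : ℂ) ≠ 0 := by exact_mod_cast ha.ne'
  rw [hy]
  push_cast
  field_simp
  ring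

/-! ### Immersions of planar sets and their continuation. -/

namespace DilationAtlas

variable {X : Type*} [TopologicalSpace X]

/-- In the chart `e`, the map `Φ` is a dilation of ratio `a` near `z`. -/
def HasScaleAt (Φ : ℂ → X) (z : ℂ) (e : PartialEquiv X ℂ) (a : ℝ) : Prop :=
  0 < a ∧ Φ z ∈ e.source ∧
    ∀ᶠ w in 𝓝 z, Φ w ∈ e.source ∧ e (Φ w) = e (Φ z) + (a : ℂ) * (w - z)

/-- `Φ` is near `z` an inverse of a chart, up to a dilation. -/
def ImmersedAt (S : DilationAtlas X) (Φ : ℂ → X) (z : ℂ) : Prop :=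
  ∃ e ∈ S.charts, ∃ a, HasScaleAt Φ z e a

variable {S : DilationAtlas X} {Φ Ψ : ℂ → X} {z : ℂ} {e : PartialEquiv X ℂ} {a : ℝ}

theorem HasScaleAt.continuousAt (he : e ∈ S.charts) (h : HasScaleAt Φ z e a) :
    ContinuousAt Φ z := by
  obtain ⟨ha, hz, h⟩ := h
  have h1 : Tendsto (fun w => e (Φ z) + (a : ℂ) * (w - z)) (𝓝 z) (𝓝 (e (Φ z))) := by
    have : ContinuousAt (fun w => e (Φ z) + (a : ℂ) * (w - z)) z := by fun_prop
    simpa [ContinuousAt] using this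
  have h2 : Tendsto (fun w => e (Φ w)) (𝓝 z) (𝓝[e.target] (e (Φ z))) := by
    refine tendsto_nhdsWithin_iff.2 ⟨h1.congr' (h.mono fun w hw => hw.2.symm), ?_⟩
    exact h.mono fun w hw => e.map_source hw.1
  have h3 := (S.continuousOn_symm e he (e (Φ z)) (e.map_source hz)).tendsto.comp h2
  rw [e.left_inv hz] at h3
  exact h3.congr' (h.mono fun w hw => e.left_inv hw.1)

theorem HasScaleAt.eventually (h : HasScaleAt Φ z e a) : ∀ᶠ w in 𝓝 z, HasScaleAt Φ w e a := by
  obtain ⟨ha, hz, h⟩ := h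
  filter_upwards [h.eventually_nhds] with w hw
  refine ⟨ha, hw.self_of_nhds.1, ?_⟩
  filter_upwards [hw] with v hv
  refine ⟨hv.1, ?_⟩
  rw [hv.2, hw.self_of_nhds.2]
  ring

theorem HasScaleAt.congr (h : HasScaleAt Φ z e a) (hΨ : Ψ =ᶠ[𝓝 z] Φ) : HasScaleAt Ψ z e a := by
  obtain ⟨ha, hz, h⟩ := h
  refine ⟨ha, by rwa [hΨ.eq_of_nhds], ?_⟩
  filter_upwards [h, hΨ] with w hw hw'
  rw [hw', hΨ.eq_of_nhds]
  exact hw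

theorem eq_of_affine_eventually {c c' b b' : ℂ}
    (h : ∀ᶠ w in 𝓝 z, b + c * (w - z) = b' + c' * (w - z)) : b = b' ∧ c = c' := by
  have h0 : b = b' := by simpa using h.self_of_nhds
  obtain ⟨w, hw, hne⟩ := ((h.filter_mono nhdsWithin_le_nhds).and
    (self_mem_nhdsWithin : {z}ᶜ ∈ 𝓝[≠] z)).exists
  refine ⟨h0, ?_⟩
  subst h0
  exact mul_right_cancel₀ (sub_ne_zero.2 hne) (add_left_cancel hw)

theorem HasScaleAt.unique {a' : ℝ} (h : HasScaleAt Φ z e a) (h' : HasScaleAt Φ z e a') :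
    a = a' := by
  have := (eq_of_affine_eventually (z := z) (c := a) (c' := a') (b := e (Φ z)) (b' := e (Φ z)) (by
    filter_upwards [h.2.2, h'.2.2] with w hw hw'
    rw [← hw.2, ← hw'.2])).2
  exact_mod_cast this

theorem ImmersedAt.continuousAt (h : S.ImmersedAt Φ z) : ContinuousAt Φ z := by
  obtain ⟨e, he, a, h⟩ := h
  exact h.continuousAt he

theorem ImmersedAt.congr (h : S.ImmersedAt Φ z) (hΨ : Ψ =ᶠ[𝓝 z] Φ) : S.ImmersedAt Ψ z := by
  obtain ⟨e, he, a, h⟩ := h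
  exact ⟨e, he, a, h.congr hΨ⟩

theorem ImmersedAt.notMem_sing (h : S.ImmersedAt Φ z) : Φ z ∉ S.sing := by
  obtain ⟨e, he, a, h⟩ := h
  exact S.source_subset e he h.2.1

/-- Since transition maps are dilations, an immersion can be read in any chart around its value.
This allows scales at different points over the same `y` to be compared in one fixed chart. -/
theorem ImmersedAt.exists_hasScaleAt (h : S.ImmersedAt Φ z) (he : e ∈ S.charts)
    (hz : Φ z ∈ e.source) : ∃ a, HasScaleAt Φ z e a := by
  have hc := h.continuousAt
  obtain ⟨f, hf, c, hc0, hzf, hw⟩ := h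
  obtain ⟨a, b, ha, hab⟩ := S.transition f hf e he (Φ z) ⟨hzf, hz⟩
  refine ⟨a * c, mul_pos ha hc0, hz, ?_⟩
  filter_upwards [hw, hc.eventually hab, hc.eventually ((S.isOpen_source e he).mem_nhds hz)]
    with w h1 h2 h3
  refine ⟨h3, ?_⟩
  rw [h2, hab.self_of_nhds, h1.2]
  push_cast
  ring

theorem HasScaleAt.exists_injOn (h : HasScaleAt Φ z e a) : ∃ O ∈ 𝓝 z, InjOn Φ O := by
  obtain ⟨ha, hz, h⟩ := h
  refine ⟨_, h, fun w hw w' hw' hww => ?_⟩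
  have h1 := hw.2
  have h2 := hw'.2
  rw [hww, h2] at h1
  have h3 := mul_left_cancel₀ (by exact_mod_cast ha.ne') (add_left_cancel h1)
  exact (sub_left_inj.1 h3).symm

theorem ImmersedAt.exists_injOn (h : S.ImmersedAt Φ z) : ∃ O ∈ 𝓝 z, InjOn Φ O := by
  obtain ⟨e, he, a, h⟩ := h
  exact h.exists_injOn

/-- Solving the affine expression of `Φ` in the chart gives an explicit local section. In particular
immersions are open maps, and a chart met by an immersion is not at an edge of its target. -/
theorem HasScaleAt.eventually_eq (he : e ∈ S.charts) (h : HasScaleAt Φ z e a) :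
    ∀ᶠ y in 𝓝 (Φ z), y ∈ e.source ∧ Φ (z + (e y - e (Φ z)) / a) = y := by
  obtain ⟨ha, hz, h⟩ := h
  have hopen := (S.isOpen_source e he).mem_nhds hz
  have hcont : ContinuousAt e (Φ z) := (S.continuousOn_chart e he).continuousAt hopen
  have h1 : Tendsto (fun y => z + (e y - e (Φ z)) / a) (𝓝 (Φ z)) (𝓝 z) := by
    have : ContinuousAt (fun y => z + (e y - e (Φ z)) / a) (Φ z) := by fun_prop
    simpa [ContinuousAt] using this
  filter_upwards [h1.eventually h, hopen] with y hy hy'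
  refine ⟨hy', e.injOn hy.1 hy' ?_⟩
  have : (a : ℂ) ≠ 0 := by exact_mod_cast ha.ne'
  rw [hy.2]
  field_simp
  ring

theorem ImmersedAt.image_mem_nhds (h : S.ImmersedAt Φ z) {O : Set ℂ} (hO : O ∈ 𝓝 z) :
    Φ '' O ∈ 𝓝 (Φ z) := by
  obtain ⟨e, he, a, h⟩ := h
  have hcont : ContinuousAt e (Φ z) :=
    (S.continuousOn_chart e he).continuousAt ((S.isOpen_source e he).mem_nhds h.2.1)
  have h1 : Tendsto (fun y => z + (e y - e (Φ z)) / a) (𝓝 (Φ z)) (𝓝 z) := by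
    have : ContinuousAt (fun y => z + (e y - e (Φ z)) / a) (Φ z) := by fun_prop
    simpa [ContinuousAt] using this
  filter_upwards [h.eventually_eq he, h1.eventually hO] with y hy hy'
  exact ⟨_, hy', hy.2⟩

theorem hasScaleAt_symm {b : ℂ} (ha : 0 < a)
    (h : e.target ∈ 𝓝 (b + a * z)) : HasScaleAt (fun w => e.symm (b + a * w)) z e a := by
  refine ⟨ha, e.map_target (mem_of_mem_nhds h), ?_⟩
  have h1 : Tendsto (fun w : ℂ => b + a * w) (𝓝 z) (𝓝 (b + a * z)) := by
    have : ContinuousAt (fun w : ℂ => b + a * w) z := by fun_prop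
    exact this
  filter_upwards [h1.eventually h] with w hw
  refine ⟨e.map_target hw, ?_⟩
  rw [e.right_inv hw, e.right_inv (mem_of_mem_nhds h)]
  ring

theorem HasScaleAt.comp_dilation {l : ℝ} {b : ℂ} (hl : 0 < l) (h : HasScaleAt Φ (l * z + b) e a) :
    HasScaleAt (fun w => Φ (l * w + b)) z e (a * l) := by
  obtain ⟨ha, hz, h⟩ := h
  refine ⟨mul_pos ha hl, hz, ?_⟩
  have h1 : Tendsto (fun w : ℂ => l * w + b) (𝓝 z) (𝓝 (l * z + b)) := by
    have : ContinuousAt (fun w : ℂ => l * w + b) z := by fun_prop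
    exact this
  filter_upwards [h1.eventually h] with w hw
  refine ⟨hw.1, ?_⟩
  rw [hw.2]
  push_cast
  ring

theorem ImmersedAt.comp_dilation {l : ℝ} {b : ℂ} (hl : 0 < l) (h : S.ImmersedAt Φ (l * z + b)) :
    S.ImmersedAt (fun w => Φ (l * w + b)) z := by
  obtain ⟨e, he, a, h⟩ := h
  exact ⟨e, he, _, h.comp_dilation hl⟩

variable [T2Space X]

/-- Immersions that agree near a point of a preconnected set agree on that set. -/
theorem eqOn_of_eventuallyEq {V : Set ℂ} (hV : IsPreconnected V)
    (hΦ : ∀ w ∈ V, S.ImmersedAt Φ w) (hΨ : ∀ w ∈ V, S.ImmersedAt Ψ w)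
    (hz : z ∈ V) (h : Φ =ᶠ[𝓝 z] Ψ) : ∀ w ∈ V, Φ =ᶠ[𝓝 w] Ψ := by
  have hopen : IsOpen {w | Φ =ᶠ[𝓝 w] Ψ} := isOpen_iff_eventually.2 fun w hw => hw.eventually_nhds
  refine hV.subset_of_closure_inter_subset hopen ⟨z, hz, h⟩ fun w hw => ?_
  obtain ⟨hwc, hwV⟩ := hw
  by_cases hmem : w ∈ {w | Φ =ᶠ[𝓝 w] Ψ}
  · exact hmem
  have : (𝓝[{w | Φ =ᶠ[𝓝 w] Ψ}] w).NeBot := mem_closure_iff_nhdsWithin_neBot.1 hwc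
  have hev : ∀ᶠ v in 𝓝[{w | Φ =ᶠ[𝓝 w] Ψ}] w, Φ v = Ψ v := by
    filter_upwards [self_mem_nhdsWithin] with v hv
    exact hv.eq_of_nhds
  -- At a limit point of the agreement set the values agree by the Hausdorff property. The two
  -- scales then agree because both affine expressions coincide at some `v ≠ w`. So the agreement
  -- set is relatively closed.
  have heq : Φ w = Ψ w := tendsto_nhds_unique_of_eventuallyEq
    ((hΦ w hwV).continuousAt.tendsto.mono_left nhdsWithin_le_nhds)
    ((hΨ w hwV).continuousAt.tendsto.mono_left nhdsWithin_le_nhds) hev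
  obtain ⟨e, he, a, ha⟩ := hΦ w hwV
  obtain ⟨a', ha'⟩ := (hΨ w hwV).exists_hasScaleAt he (heq ▸ ha.2.1)
  obtain ⟨v, hv, h1, h2, hvu⟩ := (hev.and ((ha.2.2.filter_mono nhdsWithin_le_nhds).and
    ((ha'.2.2.filter_mono nhdsWithin_le_nhds).and self_mem_nhdsWithin))).exists
  have hvw : v ≠ w := fun hvw => hmem (hvw ▸ hvu)
  have haa : (a : ℂ) = a' := by
    have h3 := h1.2
    rw [hv, h2.2, heq] at h3
    exact (mul_right_cancel₀ (sub_ne_zero.2 hvw) (add_left_cancel h3)).symm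
  show Φ =ᶠ[𝓝 w] Ψ
  filter_upwards [ha.2.2, ha'.2.2] with u hu hu'
  refine e.injOn hu.1 hu'.1 ?_
  rw [hu.2, hu'.2, haa, heq]

/-- The expression of an immersion in a chart persists on the convex set of points that it sends
to a disc in which the target of the chart is closed. -/
theorem HasScaleAt.continuation {G : Set ℂ} (hG : Convex ℝ G)
    (hΦ : ∀ w ∈ G, S.ImmersedAt Φ w) (he : e ∈ S.charts) (hz : z ∈ G) (h : HasScaleAt Φ z e a)
    {v : ℂ} {r : ℝ} (hr : ∀ w ∈ Metric.ball v r, w ∈ closure e.target → w ∈ e.target)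
    (hzv : e (Φ z) ∈ Metric.ball v r) {w : ℂ} (hw : w ∈ G)
    (hwv : e (Φ z) + a * (w - z) ∈ Metric.ball v r) :
    HasScaleAt Φ w e a ∧ e (Φ w) = e (Φ z) + a * (w - z) := by
  set A : ℂ → ℂ := fun w => e (Φ z) + a * (w - z) with hA
  have hAc : Continuous A := by fun_prop
  -- Both sets are convex, so an open and relatively closed condition propagates from `z` to `w`.
  have hW : IsPreconnected (G ∩ A ⁻¹' Metric.ball v r) := by
    refine (hG.inter ?_).isPreconnected
    intro p hp q hq s t hs ht hst
    have : A (s • p + t • q) = s • A p + t • A q := by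
      have hst' : (s : ℂ) + t = 1 := by exact_mod_cast hst
      simp only [hA, Complex.real_smul]
      linear_combination (-e (Φ z) + a * z) * hst'
    rw [mem_preimage, this]
    exact convex_ball v r hp hq hs ht hst
  set u : Set ℂ := {w | ∀ᶠ x in 𝓝 w, Φ x ∈ e.source ∧ e (Φ x) = A x} with hu
  have hopen : IsOpen u := isOpen_iff_eventually.2 fun w hw => hw.eventually_nhds
  have hzu : z ∈ u := h.2.2
  have key : G ∩ A ⁻¹' Metric.ball v r ⊆ u := by
    refine hW.subset_of_closure_inter_subset hopen ⟨z, ⟨hz, by simpa [hA] using hzv⟩, hzu⟩ ?_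
    rintro w ⟨hwc, hwG, hwb⟩
    by_cases hmem : w ∈ u
    · exact hmem
    have : (𝓝[u] w).NeBot := mem_closure_iff_nhdsWithin_neBot.1 hwc
    have hev : ∀ᶠ x in 𝓝[u] w, Φ x ∈ e.source ∧ e (Φ x) = A x := by
      filter_upwards [self_mem_nhdsWithin] with x hx
      have hx' : ∀ᶠ x in 𝓝 x, Φ x ∈ e.source ∧ e (Φ x) = A x := hx
      exact hx'.self_of_nhds
    have hAt : Tendsto A (𝓝[u] w) (𝓝 (A w)) := hAc.continuousAt.tendsto.mono_left nhdsWithin_le_nhds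
    have hev' : ∀ᶠ x in 𝓝[u] w, A x ∈ e.target := by
      filter_upwards [hev] with x hx
      exact hx.2 ▸ e.map_source hx.1
    -- The chart does not run out: inside the disc, limits of points of the target stay in the
    -- target.
    have hAw : A w ∈ e.target := hr _ hwb (mem_closure_of_tendsto hAt hev')
    have h1 : Tendsto (fun x => e.symm (A x)) (𝓝[u] w) (𝓝 (e.symm (A w))) :=
      (S.continuousOn_symm e he (A w) hAw).tendsto.comp (tendsto_nhdsWithin_iff.2 ⟨hAt, hev'⟩)
    have heq : Φ w = e.symm (A w) := tendsto_nhds_unique_of_eventuallyEq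
      ((hΦ w hwG).continuousAt.tendsto.mono_left nhdsWithin_le_nhds) h1 (hev.mono fun x hx => by
        show Φ x = e.symm (A x)
        rw [← hx.2, e.left_inv hx.1])
    have hws : Φ w ∈ e.source := heq ▸ e.map_target hAw
    have hew : e (Φ w) = A w := by rw [heq, e.right_inv hAw]
    obtain ⟨c, hc⟩ := (hΦ w hwG).exists_hasScaleAt he hws
    obtain ⟨x, hx1, hx2, hxu⟩ := (hev.and ((hc.2.2.filter_mono nhdsWithin_le_nhds).and
      self_mem_nhdsWithin)).exists
    have hxw : x ≠ w := fun hxw => hmem (hxw ▸ hxu)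
    have hca : (c : ℂ) = a := by
      have h3 := hx1.2
      rw [hx2.2, hew] at h3
      refine mul_right_cancel₀ (sub_ne_zero.2 hxw) ?_
      simp only [hA] at h3
      linear_combination h3
    show ∀ᶠ x in 𝓝 w, Φ x ∈ e.source ∧ e (Φ x) = A x
    filter_upwards [hc.2.2] with x hx
    refine ⟨hx.1, ?_⟩
    rw [hx.2, hew, hca]
    simp only [hA]
    ring
  have hwu : ∀ᶠ x in 𝓝 w, Φ x ∈ e.source ∧ e (Φ x) = A x := key ⟨hw, hwv⟩
  refine ⟨⟨h.1, hwu.self_of_nhds.1, ?_⟩, hwu.self_of_nhds.2⟩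
  filter_upwards [hwu] with x hx
  refine ⟨hx.1, ?_⟩
  rw [hx.2, hwu.self_of_nhds.2]
  simp only [hA]
  ring

end DilationAtlas

/-! ### Hyperbolic segments, and surfaces covered by the plane. -/

namespace DilationAtlas

variable {X : Type*} [TopologicalSpace X]

/-- `g` is a local chart at `Φ z` that is inverse to `Φ`. -/
def IsLocalInverse (S : DilationAtlas X) (Φ : ℂ → X) (z : ℂ) (g : X → ℂ) : Prop :=
  (∃ e ∈ S.charts, Φ z ∈ e.source ∧ DilationRelated (Φ z) e g) ∧ ∀ᶠ w in 𝓝 z, g (Φ w) = w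

variable {S : DilationAtlas X} {Φ : ℂ → X} {z : ℂ} {e : PartialEquiv X ℂ} {a : ℝ}

theorem HasScaleAt.isLocalInverse (he : e ∈ S.charts) (h : HasScaleAt Φ z e a) :
    S.IsLocalInverse Φ z (fun y => (a : ℂ)⁻¹ * (e y - e (Φ z)) + z) := by
  have ha : (a : ℂ) ≠ 0 := by exact_mod_cast h.1.ne'
  refine ⟨⟨e, he, h.2.1, a⁻¹, z - (a : ℂ)⁻¹ * e (Φ z), inv_pos.2 h.1, Eventually.of_forall fun y => ?_⟩,
    ?_⟩
  · push_cast
    ring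
  · filter_upwards [h.2.2] with w hw
    rw [hw.2]
    field_simp
    ring

theorem IsLocalInverse.eventuallyEq {g g' : X → ℂ} (hΦ : S.ImmersedAt Φ z)
    (h : S.IsLocalInverse Φ z g) (h' : S.IsLocalInverse Φ z g') : g =ᶠ[𝓝 (Φ z)] g' := by
  filter_upwards [hΦ.image_mem_nhds (h.2.and h'.2)]
  rintro _ ⟨w, hw, rfl⟩
  rw [hw.1, hw.2]

theorem IsLocalInverse.eventually {g : X → ℂ} (hΦ : S.ImmersedAt Φ z)
    (h : S.IsLocalInverse Φ z g) : ∀ᶠ w in 𝓝 z, S.IsLocalInverse Φ w g := by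
  obtain ⟨⟨e, he, hz, a, b, ha, hab⟩, h⟩ := h
  filter_upwards [h.eventually_nhds, hΦ.continuousAt.eventually hab.eventually_nhds,
    hΦ.continuousAt.eventually ((S.isOpen_source e he).mem_nhds hz)] with w h1 h2 h3
  exact ⟨⟨e, he, h3, a, b, ha, h2⟩, h1⟩

/-- A segment whose endpoints are identified by an immersion with different scales is mapped to a
hyperbolic closed geodesic. -/
theorem isHyperbolicClosedGeodesic_segment {G : Set ℂ} (hG : Convex ℝ G)
    (hΦ : ∀ w ∈ G, S.ImmersedAt Φ w) (he : e ∈ S.charts) {w w' : ℂ} (hw : w ∈ G) (hw' : w' ∈ G)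
    (hy : Φ w = Φ w') {a' : ℝ} (h : HasScaleAt Φ w e a) (h' : HasScaleAt Φ w' e a') (hne : a ≠ a')
    {r : ℝ} {d : Circle} (hr : 0 < r) (hd : w' - w = r * d) :
    S.IsHyperbolicClosedGeodesic (fun t : ℝ => Φ (w + t * (w' - w))) d := by
  have hmem : ∀ t ∈ Icc (0 : ℝ) 1, w + t * (w' - w) ∈ G := fun t ht => by
    have := hG.add_smul_sub_mem hw hw' ht
    simpa [Complex.real_smul] using this
  have hcont : Continuous fun t : ℝ => w + t * (w' - w) := by fun_prop
  refine ⟨⟨by simp [hy], fun t ht => ?_⟩, a / a', ?_, ?_⟩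
  · obtain ⟨f, hf, c, hc, hs, hev⟩ := hΦ _ (hmem t ht)
    refine ⟨f, hf, hs, c * r, mul_pos hc hr, ?_⟩
    filter_upwards [(hcont.continuousAt.eventually hev).filter_mono nhdsWithin_le_nhds] with s h1
    refine ⟨h1.1, ?_⟩
    rw [h1.2, hd]
    push_cast
    ring
  · have hex : ∀ t : ℝ, ∃ g : X → ℂ, t ∈ Icc (0 : ℝ) 1 → S.IsLocalInverse Φ (w + t * (w' - w)) g := by
      intro t
      by_cases ht : t ∈ Icc (0 : ℝ) 1
      · obtain ⟨f, hf, c, hc⟩ := hΦ _ (hmem t ht)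
        exact ⟨_, fun _ => hc.isLocalInverse hf⟩
      · exact ⟨fun _ => 0, fun h => absurd h ht⟩
    choose g hg using hex
    -- Local inverses of the single map `Φ` along the segment are analytic continuations of each
    -- other. At the two ends they are `a⁻¹ (e - e y₀) + w` and `a'⁻¹ (e - e y₀) + w'`, with `y₀`
    -- the common value, whence the ratio `a / a'` and this translation part.
    refine ⟨g, fun t ht => (hg t ht).1, fun t ht => ?_, w' - (a / a' : ℝ) * w, ?_⟩
    · have h1 := hcont.continuousAt.eventually ((hg t ht).eventually (hΦ _ (hmem t ht)))
      filter_upwards [h1.filter_mono nhdsWithin_le_nhds, self_mem_nhdsWithin] with s hs hsI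
      exact (hg s hsI).eventuallyEq (hΦ _ (hmem s hsI)) hs
    · have h0 := hg 0 (by simp)
      have h1 := hg 1 (by simp)
      simp only [Complex.ofReal_zero, Complex.ofReal_one, zero_mul, one_mul, add_zero,
        add_sub_cancel] at h0 h1 ⊢
      have e0 := h0.eventuallyEq (hΦ _ hw) (h.isLocalInverse he)
      have e1 := h1.eventuallyEq (hΦ _ hw') (h'.isLocalInverse he)
      rw [← hy] at e1
      filter_upwards [e0, e1] with y hy0 hy1
      have ha : (a : ℂ) ≠ 0 := by exact_mod_cast h.1.ne'
      have ha' : (a' : ℂ) ≠ 0 := by exact_mod_cast h'.1.ne'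
      rw [hy0, hy1]
      push_cast
      field_simp
      ring
  · intro h1
    rw [div_eq_one_iff_eq h'.1.ne'] at h1
    exact hne h1

variable [T2Space X]

/-- A structure without singularities developed by an immersion of the plane is a translation
structure. -/
theorem isTranslation_of_range_eq_univ (hΦ : ∀ w, S.ImmersedAt Φ w) (hr : range Φ = univ) :
    S.IsTranslation := by
  have hcont : Continuous Φ := continuous_iff_continuousAt.2 fun w => (hΦ w).continuousAt
  -- The candidate translation atlas consists of all local inverses of `Φ`.
  refine ⟨{f | IsOpen f.source ∧ ∀ x ∈ f.source, ∃ z, Φ z = x ∧ S.IsLocalInverse Φ z f}, ?_, ?_, ?_⟩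
  · rintro f ⟨hf, hx⟩
    refine ⟨hf, fun x hxs => ?_, fun e he x hxs => ?_⟩
    · obtain ⟨z, rfl, -⟩ := hx x hxs
      exact (hΦ z).notMem_sing
    · obtain ⟨z, rfl, ⟨e', he', hz, hrel⟩, -⟩ := hx x hxs.2
      exact (S.transition e he e' he' _ ⟨hxs.1, hz⟩).trans hrel
  · intro x _
    obtain ⟨z, rfl⟩ : x ∈ range Φ := hr ▸ mem_univ x
    obtain ⟨e, he, a, ha⟩ := hΦ z
    have ha0 : (a : ℂ) ≠ 0 := by exact_mod_cast ha.1.ne'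
    obtain ⟨η, hη, hball⟩ := Metric.eventually_nhds_iff_ball.1 ha.2.2
    set A : ℂ ≃ ℂ := ((Equiv.subRight (e (Φ z))).trans (Equiv.mulLeft₀ (a : ℂ)⁻¹ (inv_ne_zero ha0))).trans
      (Equiv.addRight z) with hA
    have hAv : ∀ v, A v = (a : ℂ)⁻¹ * (v - e (Φ z)) + z := fun v => rfl
    set f := (e.restr (e ⁻¹' (A ⁻¹' Metric.ball z η))).trans A.toPartialEquiv with hf
    have hsrc : f.source = e.source ∩ e ⁻¹' (A ⁻¹' Metric.ball z η) := by simp [hf]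
    have hAc : Continuous A := by
      have : (A : ℂ → ℂ) = fun v => (a : ℂ)⁻¹ * (v - e (Φ z)) + z := rfl
      rw [this]
      fun_prop
    have hfv : ∀ x, f x = (a : ℂ)⁻¹ * (e x - e (Φ z)) + z := fun v => rfl
    refine ⟨f, ⟨?_, fun x hx => ?_⟩, ?_⟩
    · rw [hsrc]
      exact (S.continuousOn_chart e he).isOpen_inter_preimage (S.isOpen_source e he)
        (Metric.isOpen_ball.preimage hAc)
    · rw [hsrc] at hx
      obtain ⟨hxs, hxb⟩ := hx
      have h1 := hball (A (e x)) hxb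
      have h2 : Φ (A (e x)) = x := by
        refine e.injOn h1.1 hxs ?_
        rw [h1.2, hAv]
        field_simp
        ring
      refine ⟨A (e x), h2, ⟨e, he, by rwa [h2], ?_⟩, ?_⟩
      · rw [h2]
        refine ⟨a⁻¹, z - (a : ℂ)⁻¹ * e (Φ z), inv_pos.2 ha.1, Eventually.of_forall fun y => ?_⟩
        rw [hfv]
        push_cast
        ring
      · filter_upwards [Metric.isOpen_ball.mem_nhds hxb] with w hw
        rw [hfv, (hball w hw).2]
        field_simp
        ring
    · rw [hsrc]
      exact ⟨ha.2.1, by simp [hAv, hη]⟩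
  · rintro e₁ ⟨-, h₁⟩ e₂ ⟨-, h₂⟩ x ⟨hx₁, hx₂⟩
    obtain ⟨z, hz, ⟨f₁, hf₁, hzf₁, hrel₁⟩, hinv₁⟩ := h₁ x hx₁
    obtain ⟨z', hz', ⟨f₂, hf₂, hzf₂, hrel₂⟩, hinv₂⟩ := h₂ x hx₂
    rw [hz] at hzf₁ hrel₁
    rw [hz'] at hzf₂ hrel₂
    obtain ⟨l, b, hl, hlb⟩ :=
      (hrel₁.symm.trans (S.transition f₁ hf₁ f₂ hf₂ x ⟨hzf₁, hzf₂⟩)).trans hrel₂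
    have hzz : z' = l * z + b := by
      have h3 := hlb.self_of_nhds
      rw [← hinv₁.self_of_nhds, ← hinv₂.self_of_nhds, hz, hz', h3]
    have hinj : ∃ N ∈ 𝓝 x, InjOn e₂ N := by
      obtain ⟨c, b', hc, hcb⟩ := hrel₂
      refine ⟨_, (hcb.and ((S.isOpen_source f₂ hf₂).mem_nhds hzf₂)), fun p hp q hq hpq => ?_⟩
      rw [hp.1, hq.1] at hpq
      exact f₂.injOn hp.2 hq.2 (mul_left_cancel₀ (by exact_mod_cast hc.ne') (add_right_cancel hpq))
    obtain ⟨N, hN, hinj⟩ := hinj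
    have hlc : Tendsto (fun w : ℂ => l * w + b) (𝓝 z) (𝓝 z') := by
      rw [hzz]
      exact (by fun_prop : Continuous fun w : ℂ => l * w + b).continuousAt
    -- A transition map `w ↦ l w + b` between two inverses of `Φ` is a local symmetry of `Φ`. The
    -- identity principle makes it a symmetry on the whole plane.
    have hloc : Φ =ᶠ[𝓝 z] fun w => Φ (l * w + b) := by
      have hN₁ : ∀ᶠ w in 𝓝 z, Φ w ∈ N := hcont.continuousAt (hz.symm ▸ hN)
      have hN₂ : ∀ᶠ w in 𝓝 z', Φ w ∈ N := hcont.continuousAt (hz'.symm ▸ hN)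
      have hl₁ : ∀ᶠ w in 𝓝 z, e₂ (Φ w) = l * e₁ (Φ w) + b :=
        hcont.continuousAt.eventually (hz.symm ▸ hlb)
      filter_upwards [hN₁, hlc.eventually hN₂, hl₁, hinv₁, hlc.eventually hinv₂] with w i1 i2 i3 i4 i5
      refine hinj i1 i2 ?_
      rw [i3, i4, i5]
    have hglob := eqOn_of_eventuallyEq isPreconnected_univ (fun w _ => hΦ w)
      (fun w _ => (hΦ (l * w + b)).comp_dilation hl) (mem_univ z) hloc
    -- Otherwise the dilation has a fixed point `p`, and invariance of `Φ` multiplies its scale at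
    -- `p` by `l`.
    have hl1 : l = 1 := by
      by_contra hne
      have hne' : (1 : ℂ) - l ≠ 0 := sub_ne_zero.2 (by exact_mod_cast Ne.symm hne)
      set p : ℂ := b / (1 - l) with hp
      have hfix : l * p + b = p := by
        rw [hp]
        field_simp
        ring
      obtain ⟨f, hf, c, hc⟩ := hΦ p
      have hc' : HasScaleAt Φ p f (c * l) := by
        have h4 : HasScaleAt Φ (l * p + b) f c := by rwa [hfix]
        exact (h4.comp_dilation hl).congr (hglob p (mem_univ p))
      have := hc.unique hc'
      exact hne (mul_left_cancel₀ hc.1.ne' (by linarith))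
    refine ⟨b, ?_⟩
    filter_upwards [hlb] with y hy
    rw [hy, hl1]
    simp

end DilationAtlas

/-! ### Conical neighbourhoods of singularities and the apex seen by an immersion. -/

theorem IsPreconnected.eq_of_locally_eq {α β : Type*} [TopologicalSpace α] {V : Set α}
    (hV : IsPreconnected V) {f : α → β} (hf : ∀ z ∈ V, ∀ᶠ w in 𝓝[V] z, f w = f z) {z w : α}
    (hz : z ∈ V) (hw : w ∈ V) : f z = f w := by
  -- With the discrete topology on the values, locally constant means continuous.
  let _ : TopologicalSpace β := ⊥
  have : DiscreteTopology β := ⟨rfl⟩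
  refine hV.constant (f := f) (fun z hz => ?_) hz hw
  rw [ContinuousWithinAt, nhds_discrete, tendsto_pure]
  exact hf z hz

/-- The point at angle `θ` and at distance `s e ^ (τ θ)` from the origin, where `p = (s, θ)`. -/
def conePoint (τ : ℝ) (p : ℝ × ℝ) : ℂ := ((p.1 * Real.exp (p.2 * τ) : ℝ) : ℂ) * (Circle.exp p.2 : ℂ)

theorem continuous_conePoint (τ : ℝ) : Continuous (conePoint τ) := by
  unfold conePoint
  fun_prop

theorem conePoint_eq (τ s θ : ℝ) :
    conePoint τ (s, θ) = s * (Complex.exp (θ * τ) * Complex.exp (θ * Complex.I)) := by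
  simp [conePoint, mul_assoc]

theorem conePoint_eq_mul (τ s θ : ℝ) : conePoint τ (s, θ) = s * conePoint τ (1, θ) := by
  rw [conePoint_eq, conePoint_eq]
  simp

theorem conePoint_ne_zero {τ s θ : ℝ} (hs : s ≠ 0) : conePoint τ (s, θ) ≠ 0 := by
  rw [conePoint_eq]
  simp [hs, Complex.exp_ne_zero]

theorem conePoint_add {τ s θ h : ℝ} (hh : Circle.exp h = 1) :
    conePoint τ (s, θ + h) = Real.exp (h * τ) * conePoint τ (s, θ) := by
  have h1 : Complex.exp (h * Complex.I) = 1 := by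
    rw [← Circle.coe_exp, hh, Circle.coe_one]
  rw [conePoint_eq, conePoint_eq]
  push_cast
  rw [add_mul, add_mul, Complex.exp_add, Complex.exp_add, h1]
  ring

/-- A branch of the logarithm of `(w - p) / v` near `w = p + v` gives the change of angle and of
modulus. The term `- τ * im` cancels the factor `e ^ (τ θ)` built into `conePoint`. -/
theorem exists_conePoint_inverse (τ : ℝ) {s θ c : ℝ} (hs : 0 < s) (hc : 0 < c) (p : ℂ) :
    ∃ κ : ℂ → ℝ × ℝ, Tendsto κ (𝓝 (p + c * conePoint τ (s, θ))) (𝓝 (s, θ)) ∧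
      ∀ᶠ w in 𝓝 (p + c * conePoint τ (s, θ)), p + c * conePoint τ (κ w) = w := by
  set v : ℂ := c * conePoint τ (s, θ) with hv
  have hv0 : v ≠ 0 := mul_ne_zero (by exact_mod_cast hc.ne') (conePoint_ne_zero hs.ne')
  set L : ℂ → ℂ := fun w => Complex.log ((w - p) / v) with hL
  have hLz : L (p + v) = 0 := by simp [hL, hv0]
  have hLc : ContinuousAt L (p + v) := by
    refine ContinuousAt.clog (by fun_prop) ?_
    simp [hv0]
  have hL0 : Tendsto L (𝓝 (p + v)) (𝓝 0) := by
    have := hLc.tendsto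
    rwa [hLz] at this
  refine ⟨fun w => (s * Real.exp ((L w).re - τ * (L w).im), θ + (L w).im), ?_, ?_⟩
  · have hc : Continuous fun ω : ℂ => (s * Real.exp (ω.re - τ * ω.im), θ + ω.im) := by fun_prop
    have := (hc.tendsto 0).comp hL0
    simpa [Function.comp_def] using this
  · have hne : ∀ᶠ w in 𝓝 (p + v), (w - p) / v ≠ 0 := by
      have hcw : ContinuousAt (fun w => (w - p) / v) (p + v) := by fun_prop
      refine hcw.eventually_ne ?_
      simp [hv0]
    filter_upwards [hne] with w hw
    have hexp : Complex.exp (L w) = (w - p) / v := Complex.exp_log hw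
    have hsplit : conePoint τ (s * Real.exp ((L w).re - τ * (L w).im), θ + (L w).im) =
        conePoint τ (s, θ) * Complex.exp (L w) := by
      rw [conePoint_eq, conePoint_eq]
      conv_rhs => rw [← Complex.re_add_im (L w)]
      push_cast
      simp only [add_mul, sub_eq_add_neg, Complex.exp_add, Complex.exp_neg]
      rw [mul_comm (τ : ℂ) ((L w).im : ℂ)]
      have := Complex.exp_ne_zero (((L w).im : ℂ) * τ)
      field_simp
    rw [hsplit, ← mul_assoc, ← hv, hexp]
    field_simp
    ring

namespace DilationAtlas

variable {X : Type*} [TopologicalSpace X]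

/-- A common description of the conical neighbourhoods of the singularities: the angle runs in
`Θ`, and for a closed cone (`Θ = univ`) distances are multiplied by `e ^ (τ θ)`. -/
structure IsConeChart (S : DilationAtlas X) (x : X) (τ : ℝ) (Θ : Set ℝ) (E : ℝ × ℝ → X) :
    Prop where
  continuousOn : ContinuousOn E (Ico 0 1 ×ˢ Θ)
  isOpen : IsOpen (E '' (Ico 0 1 ×ˢ Θ))
  apex : ∀ θ ∈ Θ, E (0, θ) = x
  shift : ∀ s ∈ Ioo (0 : ℝ) 1, ∀ s' ∈ Ico (0 : ℝ) 1, ∀ θ ∈ Θ, ∀ θ' ∈ Θ, E (s, θ) = E (s', θ') →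
    s = s' ∧ ∃ h : ℝ, Circle.exp h = 1 ∧ θ' = θ + h ∧ ∀ σ ∈ Ioo (0 : ℝ) 1, E (σ, θ') = E (σ, θ)
  chart : ∀ s ∈ Ioo (0 : ℝ) 1, ∀ θ ∈ Θ, ∃ e ∈ S.charts, ∃ (a : ℝ) (b : ℂ), 0 < a ∧
    E (s, θ) ∈ e.source ∧ ∀ᶠ q in 𝓝[Ico 0 1 ×ˢ Θ] (s, θ), E q ∈ e.source ∧
      e (E q) = (a : ℂ) * conePoint τ q + b

/-- The factor `ρ ^ (θ / 2πk)` is `e ^ (τ θ)` for `τ = log ρ / 2πk`. A full turn is a multiple of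
`2πk`, hence invisible to `Circle.exp`. -/
theorem IsInteriorCone.exists_isConeChart {S : DilationAtlas X} {x : X} {k : ℕ} {ρ : ℝ}
    (h : S.IsInteriorCone x k ρ) : ∃ τ E, S.IsConeChart x τ univ E := by
  obtain ⟨hk, hρ, E, h1, h2, h3, h4, h5⟩ := h
  refine ⟨Real.log ρ / (2 * Real.pi * k), E, h1, h2, fun θ _ => h3 θ, ?_, ?_⟩
  · intro s hs s' hs' θ _ θ' _ hE
    rcases (h4 s ⟨hs.1.le, hs.2⟩ s' hs' θ θ').1 hE with h | ⟨rfl, n, hn⟩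
    · exact absurd h.1 hs.1.ne'
    · refine ⟨rfl, n * (2 * Real.pi * k), ?_, hn, fun σ hσ => ?_⟩
      · rw [Circle.exp_eq_one]
        exact ⟨n * k, by push_cast; ring⟩
      · exact ((h4 σ ⟨hσ.1.le, hσ.2⟩ σ ⟨hσ.1.le, hσ.2⟩ θ θ').2 (Or.inr ⟨rfl, n, hn⟩)).symm
  · intro s hs θ _
    obtain ⟨e, he, a, b, ha, hs', hev⟩ := h5 s hs θ
    refine ⟨e, he, a, b, ha, hs', (hev.filter_mono nhdsWithin_le_nhds).mono fun q hq => ⟨hq.1, ?_⟩⟩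
    rw [hq.2, conePoint, Real.rpow_def_of_pos hρ]
    congr 6
    ring

theorem IsBoundaryCone.exists_isConeChart {S : DilationAtlas X} {x : X} {θ₀ α : ℝ}
    (h : S.IsBoundaryCone x θ₀ α) : ∃ E, S.IsConeChart x 0 (Icc θ₀ (θ₀ + α)) E ∧
      ∀ s ∈ Ioo (0 : ℝ) 1, ∀ s' ∈ Ico (0 : ℝ) 1, ∀ θ ∈ Icc θ₀ (θ₀ + α), ∀ θ' ∈ Icc θ₀ (θ₀ + α),
        E (s, θ) = E (s', θ') → s = s' ∧ θ = θ' := by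
  obtain ⟨hα, E, h1, h2, h3, h4, h5⟩ := h
  have hinj : ∀ s ∈ Ioo (0 : ℝ) 1, ∀ s' ∈ Ico (0 : ℝ) 1, ∀ θ ∈ Icc θ₀ (θ₀ + α),
      ∀ θ' ∈ Icc θ₀ (θ₀ + α), E (s, θ) = E (s', θ') → s = s' ∧ θ = θ' := by
    intro s hs s' hs' θ hθ θ' hθ' hE
    rcases (h4 s ⟨hs.1.le, hs.2⟩ s' hs' θ hθ θ' hθ').1 hE with h | h
    · exact absurd h.1 hs.1.ne'
    · exact h
  refine ⟨E, ⟨h1, h2, h3, ?_, ?_⟩, hinj⟩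
  · intro s hs s' hs' θ hθ θ' hθ' hE
    obtain ⟨rfl, rfl⟩ := hinj s hs s' hs' θ hθ θ' hθ' hE
    exact ⟨rfl, 0, by simp, by simp, fun _ _ => rfl⟩
  · intro s hs θ hθ
    obtain ⟨e, he, a, b, ha, hs', hev⟩ := h5 s hs θ hθ
    refine ⟨e, he, a, b, ha, hs', hev.mono fun q hq => ⟨hq.1, ?_⟩⟩
    rw [hq.2]
    simp [conePoint]

/-- Near `(s, θ)`, the map `Φ` sends the cone with apex `p` and scale `c` as `E` does. -/
def IsAdapted (Φ : ℂ → X) (E : ℝ × ℝ → X) (τ : ℝ) (Θ : Set ℝ) (p : ℂ) (c s θ : ℝ) : Prop :=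
  0 < c ∧ s ∈ Ioo (0 : ℝ) 1 ∧ θ ∈ Θ ∧
    ∀ᶠ q in 𝓝[Ico 0 1 ×ˢ Θ] (s, θ), Φ (p + c * conePoint τ q) = E q

variable {S : DilationAtlas X} {Φ : ℂ → X} {z p : ℂ} {x : X} {τ c s θ : ℝ} {Θ : Set ℝ}
  {E : ℝ × ℝ → X}

theorem IsAdapted.eq (h : IsAdapted Φ E τ Θ p c s θ) : Φ (p + c * conePoint τ (s, θ)) = E (s, θ) :=
  h.2.2.2.self_of_nhdsWithin ⟨⟨h.2.1.1.le, h.2.1.2⟩, h.2.2.1⟩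

theorem IsAdapted.eventually_radial (h : IsAdapted Φ E τ Θ p c s θ) :
    ∀ᶠ σ in 𝓝 s, IsAdapted Φ E τ Θ p c σ θ := by
  have h1 : Tendsto (fun σ : ℝ => (σ, θ)) (𝓝 s) (𝓝[Ico 0 1 ×ˢ Θ] (s, θ)) := by
    refine tendsto_nhdsWithin_iff.2 ⟨(by fun_prop : Continuous fun σ : ℝ => (σ, θ)).tendsto s, ?_⟩
    filter_upwards [Ioo_mem_nhds h.2.1.1 h.2.1.2] with σ hσ
    exact ⟨⟨hσ.1.le, hσ.2⟩, h.2.2.1⟩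
  filter_upwards [h1.eventually (eventually_eventually_nhdsWithin.2 h.2.2.2),
    Ioo_mem_nhds h.2.1.1 h.2.1.2] with σ h2 h3
  exact ⟨h.1, h3, h.2.2.1, h2⟩

theorem IsConeChart.exists_isAdapted (hE : S.IsConeChart x τ Θ E) (hΦ : S.ImmersedAt Φ z)
    (hs : s ∈ Ioo (0 : ℝ) 1) (hθ : θ ∈ Θ) (hz : Φ z = E (s, θ)) :
    ∃ (p : ℂ) (c : ℝ), z = p + c * conePoint τ (s, θ) ∧ IsAdapted Φ E τ Θ p c s θ := by
  obtain ⟨e, he, a, b, ha, hsrc, hev⟩ := hE.chart s hs θ hθ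
  obtain ⟨c', hc'⟩ := hΦ.exists_hasScaleAt he (hz ▸ hsrc)
  have hc0 : (c' : ℂ) ≠ 0 := by exact_mod_cast hc'.1.ne'
  have hz0 : e (Φ z) = a * conePoint τ (s, θ) + b := by
    rw [hz]
    exact (hev.self_of_nhdsWithin ⟨⟨hs.1.le, hs.2⟩, hθ⟩).2
  set c := a / c' with hc
  set p : ℂ := z - c * conePoint τ (s, θ) with hp
  have hzp : z = p + c * conePoint τ (s, θ) := by rw [hp]; ring
  refine ⟨p, c, hzp, div_pos ha hc'.1, hs, hθ, ?_⟩
  have h1 : Tendsto (fun q => p + c * conePoint τ q) (𝓝[Ico 0 1 ×ˢ Θ] (s, θ)) (𝓝 z) := by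
    have hcq : Continuous fun q => p + c * conePoint τ q := by
      have := continuous_conePoint τ
      fun_prop
    have := hcq.tendsto (s, θ)
    rw [← hzp] at this
    exact this.mono_left nhdsWithin_le_nhds
  filter_upwards [h1.eventually hc'.2.2, hev] with q h2 h3
  refine e.injOn h2.1 h3.1 ?_
  rw [h2.2, h3.2, hz0, hp, hc]
  push_cast
  field_simp
  ring

/-- The apex of the cone seen by an immersion is determined by the immersion. -/
theorem IsConeChart.apex_unique (hE : S.IsConeChart x τ Θ E) (hΦ : S.ImmersedAt Φ z)
    {p' : ℂ} {c' s' θ' : ℝ} (h : IsAdapted Φ E τ Θ p c s θ) (h' : IsAdapted Φ E τ Θ p' c' s' θ')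
    (hz : z = p + c * conePoint τ (s, θ)) (hz' : z = p' + c' * conePoint τ (s', θ')) :
    p = p' ∧ (τ = 0 → c = c') := by
  have heq : E (s, θ) = E (s', θ') := by rw [← h.eq, ← h'.eq, ← hz, ← hz']
  obtain ⟨rfl, k, hk, rfl, hkE⟩ := hE.shift s h.2.1 s' ⟨h'.2.1.1.le, h'.2.1.2⟩ θ h.2.2.1 θ' h'.2.2.1 heq
  obtain ⟨O, hO, hinj⟩ := hΦ.exists_injOn
  have t1 : Tendsto (fun σ : ℝ => p + c * conePoint τ (σ, θ)) (𝓝 s) (𝓝 z) := by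
    rw [hz]
    have := continuous_conePoint τ
    exact (by fun_prop : Continuous fun σ : ℝ => p + c * conePoint τ (σ, θ)).tendsto s
  have t2 : Tendsto (fun σ : ℝ => p' + c' * conePoint τ (σ, θ + k)) (𝓝 s) (𝓝 z) := by
    rw [hz']
    have := continuous_conePoint τ
    exact (by fun_prop : Continuous fun σ : ℝ => p' + c' * conePoint τ (σ, θ + k)).tendsto s
  -- Two adapted descriptions of the same point send the same radial segment to the surface.
  -- Injectivity of `Φ` near `z` makes the two planar segments coincide as functions of `σ`;
  -- comparing slopes and constant terms gives the result.
  have hev : ∀ᶠ σ in 𝓝 s, p + c * conePoint τ (σ, θ) = p' + c' * conePoint τ (σ, θ + k) := by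
    filter_upwards [t1.eventually hO, t2.eventually hO, h.eventually_radial, h'.eventually_radial]
      with σ h1 h2 h3 h4
    refine hinj h1 h2 ?_
    rw [h3.eq, h4.eq, hkE σ h3.2.1]
  obtain ⟨σ, hσ, hne⟩ := ((hev.filter_mono nhdsWithin_le_nhds).and
    (self_mem_nhdsWithin : {s}ᶜ ∈ 𝓝[≠] s)).exists
  have hs := hev.self_of_nhds
  rw [conePoint_add hk, conePoint_eq_mul] at hs hσ
  have hu : conePoint τ (1, θ) ≠ 0 := conePoint_ne_zero one_ne_zero
  have hne' : ((σ : ℂ) - s) ≠ 0 := sub_ne_zero.2 (by exact_mod_cast hne)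
  have hcc : (c : ℂ) = c' * Real.exp (k * τ) := by
    refine mul_right_cancel₀ (mul_ne_zero hne' hu) ?_
    linear_combination hσ - hs
  refine ⟨?_, fun h0 => ?_⟩
  · rw [hcc] at hs
    linear_combination hs
  · subst h0
    simp at hcc
    exact_mod_cast hcc

/-- Away from the edges, polar coordinates around `p` parametrize a full neighbourhood, so the same
apex and scale serve nearby points. Edge angles are excluded because there `E` covers only one side.
-/
theorem IsAdapted.eventually (h : IsAdapted Φ E τ Θ p c s θ) (hθ : θ ∈ interior Θ) :
    ∀ᶠ w in 𝓝 (p + c * conePoint τ (s, θ)), ∃ σ, ∃ ϑ ∈ interior Θ,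
      w = p + c * conePoint τ (σ, ϑ) ∧ IsAdapted Φ E τ Θ p c σ ϑ := by
  obtain ⟨hc, hs, hθΘ, hev⟩ := h
  have hN : Ioo (0 : ℝ) 1 ×ˢ interior Θ ∈ 𝓝 (s, θ) :=
    prod_mem_nhds (Ioo_mem_nhds hs.1 hs.2) (isOpen_interior.mem_nhds hθ)
  have hsub : Ioo (0 : ℝ) 1 ×ˢ interior Θ ⊆ Ico 0 1 ×ˢ Θ :=
    prod_mono Ioo_subset_Ico_self interior_subset
  rw [nhdsWithin_eq_nhds.2 (mem_of_superset hN hsub)] at hev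
  obtain ⟨κ, hκ, hκw⟩ := exists_conePoint_inverse τ (θ := θ) hs.1 hc p
  filter_upwards [hκ.eventually hev.eventually_nhds, hκ.eventually hN, hκw] with w h1 h2 h3
  exact ⟨(κ w).1, (κ w).2, h2.2, h3.symm, hc, h2.1, interior_subset h2.2,
    h1.filter_mono nhdsWithin_le_nhds⟩

/-- An immersion of a preconnected set into the regular part of a conical neighbourhood sees a
single apex. -/
theorem IsConeChart.exists_apex (hE : S.IsConeChart x τ Θ E) {V : Set ℂ} (hV : IsPreconnected V)
    (hΦ : ∀ z ∈ V, S.ImmersedAt Φ z)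
    (hVE : ∀ z ∈ V, ∃ s ∈ Ioo (0 : ℝ) 1, ∃ θ ∈ interior Θ, Φ z = E (s, θ)) :
    ∃ (p : ℂ) (c₀ : ℝ), ∀ z ∈ V, ∃ c s θ : ℝ, z = p + c * conePoint τ (s, θ) ∧ IsAdapted Φ E τ Θ p c s θ ∧
      (τ = 0 → c = c₀) := by
  rcases V.eq_empty_or_nonempty with rfl | ⟨z₀, hz₀⟩
  · exact ⟨0, 0, by simp⟩
  have hex : ∀ z, ∃ p : ℂ, ∃ c s θ : ℝ, z ∈ V → θ ∈ interior Θ ∧ z = p + c * conePoint τ (s, θ) ∧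
      IsAdapted Φ E τ Θ p c s θ := by
    intro z
    by_cases hz : z ∈ V
    · obtain ⟨s, hs, θ, hθ, h⟩ := hVE z hz
      obtain ⟨p, c, h1, h2⟩ := hE.exists_isAdapted (hΦ z hz) hs (interior_subset hθ) h
      exact ⟨p, c, s, θ, fun _ => ⟨hθ, h1, h2⟩⟩
    · exact ⟨0, 0, 0, 0, fun h => absurd h hz⟩
  choose p c s θ h using hex
  -- The scale is recorded only when `τ = 0`. When `τ ≠ 0` it depends on the choice of the angle
  -- modulo a full turn, so only the apex is well defined.
  have hloc : ∀ z ∈ V, ∀ᶠ w in 𝓝[V] z,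
      (p w, if τ = 0 then c w else 0) = (p z, if τ = 0 then c z else 0) := by
    intro z hz
    obtain ⟨h1, h2, h3⟩ := h z hz
    have h4 := h3.eventually h1
    rw [← h2] at h4
    filter_upwards [h4.filter_mono nhdsWithin_le_nhds, self_mem_nhdsWithin] with w hw hwV
    obtain ⟨σ, ϑ, hϑ, hw1, hw2⟩ := hw
    obtain ⟨h5, h6, h7⟩ := h w hwV
    obtain ⟨hp, hc⟩ := hE.apex_unique (hΦ w hwV) h7 hw2 h6 hw1
    by_cases h0 : τ = 0
    · simp [h0, hp, hc h0]
    · simp [h0, hp]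
  refine ⟨p z₀, c z₀, fun z hz => ?_⟩
  have heq := hV.eq_of_locally_eq hloc hz hz₀
  obtain ⟨h1, h2, h3⟩ := h z hz
  rw [Prod.mk.injEq] at heq
  rw [← heq.1]
  exact ⟨c z, s z, θ z, h2, h3, fun h0 => by simpa [h0] using heq.2⟩

/-- A ray starting at the apex leaves the conical neighbourhood. -/
theorem IsConeChart.not_forall_ray (hE : S.IsConeChart x τ Θ E) {v : ℂ}
    (h : ∀ l : ℝ, 1 ≤ l → ∃ c s θ : ℝ, p + l * v = p + c * conePoint τ (s, θ) ∧
      IsAdapted Φ E τ Θ p c s θ) : False := by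
  have hex : ∀ l : ℝ, ∃ c s θ : ℝ, 1 ≤ l → p + l * v = p + c * conePoint τ (s, θ) ∧
      IsAdapted Φ E τ Θ p c s θ := by
    intro l
    by_cases hl : 1 ≤ l
    · obtain ⟨c, s, θ, hh⟩ := h l hl
      exact ⟨c, s, θ, fun _ => hh⟩
    · exact ⟨0, 0, 0, fun h => absurd h hl⟩
  choose c s θ h using hex
  -- Along the ray the cone radius `s l` is proportional to `l`. Then at `l = 1 / s 1` it would
  -- equal `1`, which is outside the cone chart.
  have hloc : ∀ l ∈ Ici (1 : ℝ), ∀ᶠ m in 𝓝[Ici 1] l, s m / m = s l / l := by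
    intro l hl
    have hl0 : (0 : ℝ) < l := lt_of_lt_of_le one_pos hl
    obtain ⟨h1, h2⟩ := h l hl
    have ht : Tendsto (fun m : ℝ => s l * (m / l)) (𝓝 l) (𝓝 (s l)) := by
      have hc : Continuous fun m : ℝ => s l * (m / l) := by fun_prop
      have := hc.tendsto l
      rwa [div_self hl0.ne', mul_one] at this
    filter_upwards [(ht.eventually h2.eventually_radial).filter_mono nhdsWithin_le_nhds,
      self_mem_nhdsWithin] with m h3 hm
    have hm0 : (0 : ℝ) < m := lt_of_lt_of_le one_pos hm
    obtain ⟨h4, h5⟩ := h m hm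
    have h6 : p + m * v = p + c l * conePoint τ (s l * (m / l), θ l) := by
      have hlC : (l : ℂ) ≠ 0 := by exact_mod_cast hl0.ne'
      have h7 : (l : ℂ) * v = c l * conePoint τ (s l, θ l) := add_left_cancel h1
      rw [conePoint_eq_mul] at h7 ⊢
      push_cast
      field_simp
      linear_combination (m : ℂ) * h7
    have h8 : E (s l * (m / l), θ l) = E (s m, θ m) := by
      rw [← h3.eq, ← h5.eq, ← h6, ← h4]
    have h9 := (hE.shift _ h3.2.1 _ ⟨h5.2.1.1.le, h5.2.1.2⟩ _ h3.2.2.1 _ h5.2.2.1 h8).1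
    rw [← h9]
    field_simp
  have h1 := (h 1 le_rfl).2.2.1
  have hm : (1 : ℝ) ≤ 1 / s 1 := by rw [le_div_iff₀ h1.1]; linarith [h1.2]
  have h2 := (h (1 / s 1) hm).2.2.1
  have h3 := isPreconnected_Ici.eq_of_locally_eq hloc (mem_Ici.2 le_rfl) (mem_Ici.2 hm)
  rw [div_one, div_div_eq_mul_div, div_one] at h3
  have := mul_right_cancel₀ h1.1.ne' ((one_mul _).trans h3)
  linarith [h2.2]

variable [T2Space X]

/-- An immersion of the plane does not enter a conical neighbourhood. -/
theorem IsConeChart.false_of_plane (hE : S.IsConeChart x τ Θ E) (hx : x ∈ S.sing)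
    (hΦ : ∀ w, S.ImmersedAt Φ w) (hs : s ∈ Ioo (0 : ℝ) 1) (hθ : θ ∈ Θ) (hz : Φ z = E (s, θ)) :
    False := by
  obtain ⟨p, c, hzp, had⟩ := hE.exists_isAdapted (hΦ z) hs hθ hz
  have hcont : Continuous Φ := continuous_iff_continuousAt.2 fun w => (hΦ w).continuousAt
  have hcp := continuous_conePoint τ
  have hEc : ContinuousOn (fun σ : ℝ => E (σ, θ)) (Ico 0 1) :=
    hE.continuousOn.comp (by fun_prop) fun σ hσ => ⟨hσ, hθ⟩
  have hΦc : Continuous fun σ : ℝ => Φ (p + c * conePoint τ (σ, θ)) := by fun_prop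
  set u : Set ℝ := {σ | ∀ᶠ t in 𝓝 σ, Φ (p + c * conePoint τ (t, θ)) = E (t, θ)} with hu
  have hopen : IsOpen u := isOpen_iff_eventually.2 fun w hw => hw.eventually_nhds
  -- The radial segment of angle `θ` is followed to the apex: agreement of `Φ` with `E` is open
  -- along it, and closed by comparison with an adapted description at the limit point.
  have key : Ioo (0 : ℝ) 1 ⊆ u := by
    refine isPreconnected_Ioo.subset_of_closure_inter_subset hopen
      ⟨s, hs, had.eventually_radial.mono fun σ h => h.eq⟩ ?_
    rintro σ ⟨hσc, hσ⟩
    by_cases hmem : σ ∈ u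
    · exact hmem
    have : (𝓝[u] σ).NeBot := mem_closure_iff_nhdsWithin_neBot.1 hσc
    have hev : ∀ᶠ t in 𝓝[u] σ, Φ (p + c * conePoint τ (t, θ)) = E (t, θ) := by
      filter_upwards [self_mem_nhdsWithin] with t ht
      have ht' : ∀ᶠ t in 𝓝 t, Φ (p + c * conePoint τ (t, θ)) = E (t, θ) := ht
      exact ht'.self_of_nhds
    have hEσ : ContinuousAt (fun σ : ℝ => E (σ, θ)) σ := hEc.continuousAt (Ico_mem_nhds hσ.1 hσ.2)
    have heq : Φ (p + c * conePoint τ (σ, θ)) = E (σ, θ) := tendsto_nhds_unique_of_eventuallyEq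
      (hΦc.continuousAt.tendsto.mono_left nhdsWithin_le_nhds)
      (hEσ.tendsto.mono_left nhdsWithin_le_nhds) hev
    obtain ⟨p', c', hz', had'⟩ := hE.exists_isAdapted (hΦ _) hσ hθ heq
    obtain ⟨O, hO, hinj⟩ := (hΦ (p + c * conePoint τ (σ, θ))).exists_injOn
    have t1 : Tendsto (fun t : ℝ => p + c * conePoint τ (t, θ)) (𝓝[u] σ)
        (𝓝 (p + c * conePoint τ (σ, θ))) :=
      ((by fun_prop : Continuous fun t : ℝ => p + c * conePoint τ (t, θ)).tendsto σ).mono_left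
        nhdsWithin_le_nhds
    have t2 : Tendsto (fun t : ℝ => p' + c' * conePoint τ (t, θ)) (𝓝[u] σ)
        (𝓝 (p + c * conePoint τ (σ, θ))) := by
      rw [hz']
      exact ((by fun_prop : Continuous fun t : ℝ => p' + c' * conePoint τ (t, θ)).tendsto
        σ).mono_left nhdsWithin_le_nhds
    obtain ⟨t, ht1, ht2, ht3, ht4, htu⟩ := ((t1.eventually hO).and ((t2.eventually hO).and
      (hev.and ((had'.eventually_radial.filter_mono nhdsWithin_le_nhds).and
        self_mem_nhdsWithin)))).exists
    have hne : t ≠ σ := fun h => hmem (h ▸ htu)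
    have h1 := hinj ht1 ht2 (by rw [ht3, ht4.eq])
    rw [conePoint_eq_mul] at h1 hz'
    have hu : conePoint τ (1, θ) ≠ 0 := conePoint_ne_zero one_ne_zero
    have hne' : ((t : ℂ) - σ) ≠ 0 := sub_ne_zero.2 (by exact_mod_cast hne)
    have hcc : (c : ℂ) = c' := by
      refine mul_right_cancel₀ (mul_ne_zero hne' hu) ?_
      linear_combination h1 - hz'
    have hpp : p = p' := by
      rw [hcc] at hz'
      linear_combination hz'
    have hcc' : c = c' := by exact_mod_cast hcc
    rw [← hpp, ← hcc'] at had'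
    exact had'.eventually_radial.mono fun σ h => h.eq
  have hlim : Tendsto (fun σ : ℝ => E (σ, θ)) (𝓝[>] 0) (𝓝 x) := by
    have h1 : ContinuousWithinAt (fun σ : ℝ => E (σ, θ)) (Ico 0 1) 0 := hEc 0 (by simp)
    have h2 := h1.tendsto
    rw [hE.apex θ hθ] at h2
    refine h2.mono_left (nhdsWithin_le_of_mem ?_)
    exact mem_of_superset (Ioo_mem_nhdsGT one_pos) Ioo_subset_Ico_self
  -- Since `Φ` is defined on the whole plane, it is defined at the apex `p`, and the limit forces `Φ
  -- p = x`, a singular value.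
  have hlim' : Tendsto (fun σ : ℝ => E (σ, θ)) (𝓝[>] 0) (𝓝 (Φ p)) := by
    have h1 := (hΦc.tendsto 0).mono_left (nhdsWithin_le_nhds (s := Ioi 0))
    have h2 : conePoint τ (0, θ) = 0 := by simp [conePoint_eq]
    rw [h2, mul_zero, add_zero] at h1
    refine h1.congr' ?_
    filter_upwards [Ioo_mem_nhdsGT one_pos] with σ hσ
    have h3 : ∀ᶠ t in 𝓝 σ, Φ (p + c * conePoint τ (t, θ)) = E (t, θ) := key hσ
    exact h3.self_of_nhds
  have := tendsto_nhds_unique hlim hlim'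
  exact (hΦ p).notMem_sing (this ▸ hx)

end DilationAtlas

/-! ### Immersions avoid the edges of boundary cones. -/

theorem norm_conePoint_zero {s θ : ℝ} (hs : 0 ≤ s) : ‖conePoint 0 (s, θ)‖ = s := by
  simp [conePoint, abs_of_nonneg hs]

/-- No three points of a line are at the same distance from a given point. -/
theorem false_of_norm_eq_on_interval {p p' u : ℂ} {c r s δ : ℝ} (hc : 0 < c) (hδ : 0 < δ)
    (hu : u ≠ 0) (h : ∀ σ : ℝ, |σ - s| < δ → ‖p + c * (σ * u) - p'‖ = r) : False := by
  have hn : ∀ σ : ℝ, |σ - s| < δ →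
      (p.re - p'.re + c * σ * u.re) ^ 2 + (p.im - p'.im + c * σ * u.im) ^ 2 = r ^ 2 := by
    intro σ hσ
    rw [← h σ hσ, ← Complex.normSq_eq_norm_sq, Complex.normSq_apply]
    simp
    ring
  have h0 := hn s (by simpa using hδ)
  have h1 := hn (s + δ / 2) (by rw [add_sub_cancel_left, abs_of_pos (by positivity)]; linarith)
  have h2 := hn (s - δ / 2) (by
    rw [sub_sub_cancel_left, abs_neg, abs_of_pos (by positivity)]; linarith)
  have h3 : 0 < Complex.normSq u := Complex.normSq_pos.2 hu
  rw [Complex.normSq_apply] at h3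
  have h4 : 0 < c ^ 2 * δ ^ 2 * (u.re * u.re + u.im * u.im) := by positivity
  nlinarith

namespace DilationAtlas

variable {X : Type*} [TopologicalSpace X] [T2Space X]
variable {S : DilationAtlas X} {Φ : ℂ → X} {z p : ℂ} {x : X} {τ c s θ θ₀ θ₁ : ℝ} {Θ : Set ℝ}
  {E : ℝ × ℝ → X}

/-- At a point of an edge of a boundary cone, the points sent to a compact part of the cone lie on
one side of the edge. -/
theorem IsConeChart.eventually_mem_side (hE : S.IsConeChart x 0 (Icc θ₀ θ₁) E)
    (hinj : ∀ s ∈ Ioo (0 : ℝ) 1, ∀ s' ∈ Ico (0 : ℝ) 1, ∀ θ ∈ Icc θ₀ θ₁, ∀ θ' ∈ Icc θ₀ θ₁,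
      E (s, θ) = E (s', θ') → s = s' ∧ θ = θ')
    {g : ℝ} (hg : ∀ ϑ ∈ Icc θ₀ θ₁, 0 ≤ g * (ϑ - θ)) (hg1 : g = 1 ∨ g = -1)
    (had : IsAdapted Φ E 0 (Icc θ₀ θ₁) p c s θ) (hΦ : S.ImmersedAt Φ (p + c * conePoint 0 (s, θ)))
    {r : ℝ} (hr : r < 1) :
    ∀ᶠ w in 𝓝 (p + c * conePoint 0 (s, θ)), Φ w ∈ E '' (Icc 0 r ×ˢ Icc θ₀ θ₁) →
      0 ≤ g * ((w - p) * Complex.exp (-(θ * Complex.I))).im := by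
  obtain ⟨hc, hs, hθ, hev⟩ := id had
  obtain ⟨O, hO, hOinj⟩ := hΦ.exists_injOn
  have hcp : Continuous fun q => p + c * conePoint 0 q := by
    have := continuous_conePoint 0
    fun_prop
  have hW : ∀ᶠ q : ℝ × ℝ in 𝓝 (s, θ), (q ∈ Ico 0 1 ×ˢ Icc θ₀ θ₁ → Φ (p + c * conePoint 0 q) = E q) ∧
      p + c * conePoint 0 q ∈ O ∧ |q.2 - θ| < Real.pi := by
    refine (eventually_nhdsWithin_iff.1 hev).and (((hcp.tendsto (s, θ)).eventually hO).and ?_)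
    have h1 : Tendsto (fun q : ℝ × ℝ => |q.2 - θ|) (𝓝 (s, θ)) (𝓝 0) := by
      have h2 : Continuous fun q : ℝ × ℝ => |q.2 - θ| := by fun_prop
      simpa using h2.tendsto (s, θ)
    exact h1.eventually_lt_const Real.pi_pos
  obtain ⟨W, hWsub, hWo, hWm⟩ := eventually_nhds_iff.1 hW
  have hsub : Icc 0 r ×ˢ Icc θ₀ θ₁ ⊆ Ico (0 : ℝ) 1 ×ˢ Icc θ₀ θ₁ :=
    prod_mono (fun _ h => ⟨h.1, h.2.trans_lt hr⟩) subset_rfl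
  -- `E` is injective off the apex but not known to be a homeomorphism onto its image: points with
  -- `s` near `1` might accumulate anywhere. On the compact part this cannot happen, so nearby
  -- points with values there come from cone coordinates in `W`.
  have hK : IsCompact ((Icc 0 r ×ˢ Icc θ₀ θ₁) \ W) := (isCompact_Icc.prod isCompact_Icc).diff hWo
  have hEK : IsClosed (E '' ((Icc 0 r ×ˢ Icc θ₀ θ₁) \ W)) :=
    (hK.image_of_continuousOn (hE.continuousOn.mono (sdiff_subset.trans hsub))).isClosed
  have hnot : Φ (p + c * conePoint 0 (s, θ)) ∉ E '' ((Icc 0 r ×ˢ Icc θ₀ θ₁) \ W) := by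
    rintro ⟨⟨σ, ϑ⟩, ⟨hq, hqW⟩, hqe⟩
    rw [had.eq] at hqe
    obtain ⟨rfl, rfl⟩ := hinj s hs σ (hsub hq).1 θ hθ ϑ hq.2 hqe.symm
    exact hqW hWm
  filter_upwards [hO, hΦ.continuousAt.eventually (hEK.isOpen_compl.mem_nhds hnot)] with w hwO hw
  rintro ⟨q, hq, hqw⟩
  have hqW : q ∈ W := by
    by_contra h
    exact hw ⟨q, ⟨hq, h⟩, hqw⟩
  obtain ⟨h1, h2, h3⟩ := hWsub q hqW
  have hwq : w = p + c * conePoint 0 q := hOinj hwO h2 (by rw [h1 (hsub hq), hqw])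
  have him : ((w - p) * Complex.exp (-(θ * Complex.I))).im = c * q.1 * Real.sin (q.2 - θ) := by
    have h4 : (w - p) * Complex.exp (-(θ * Complex.I)) =
        ((c * q.1 : ℝ) : ℂ) * Complex.exp ((q.2 - θ : ℝ) * Complex.I) := by
      rw [hwq, ← Prod.mk.eta (p := q), conePoint_eq]
      push_cast
      rw [sub_mul (q.2 : ℂ), sub_eq_add_neg (q.2 * Complex.I), Complex.exp_add]
      simp
      ring
    rw [h4, Complex.im_ofReal_mul, Complex.exp_ofReal_mul_I_im]
  have hsin : 0 ≤ g * Real.sin (q.2 - θ) := by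
    have h5 := hg q.2 hq.2
    have h6 := abs_lt.1 h3
    rcases hg1 with rfl | rfl
    · rw [one_mul] at h5 ⊢
      exact Real.sin_nonneg_of_nonneg_of_le_pi h5 h6.2.le
    · have := Real.sin_nonpos_of_nonpos_of_neg_pi_le (x := q.2 - θ) (by linarith) (by linarith)
      linarith
  rw [him]
  have := hq.1.1
  calc 0 ≤ c * q.1 * (g * Real.sin (q.2 - θ)) := by positivity
    _ = _ := by ring

/-- An immersion of an open set into a boundary cone avoids the edges of the cone. -/
theorem IsConeChart.mem_interior_of_immersed (hE : S.IsConeChart x 0 (Icc θ₀ θ₁) E)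
    (hinj : ∀ s ∈ Ioo (0 : ℝ) 1, ∀ s' ∈ Ico (0 : ℝ) 1, ∀ θ ∈ Icc θ₀ θ₁, ∀ θ' ∈ Icc θ₀ θ₁,
      E (s, θ) = E (s', θ') → s = s' ∧ θ = θ')
    {V : Set ℂ} (hV : IsOpen V) (hΦ : ∀ w ∈ V, S.ImmersedAt Φ w)
    (hVE : ∀ w ∈ V, ∃ s ∈ Ioo (0 : ℝ) 1, ∃ θ ∈ Icc θ₀ θ₁, Φ w = E (s, θ)) :
    ∀ w ∈ V, ∃ s ∈ Ioo (0 : ℝ) 1, ∃ θ ∈ Ioo θ₀ θ₁, Φ w = E (s, θ) := by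
  set I : Set ℂ := {w | w ∈ V ∧ ∃ s ∈ Ioo (0 : ℝ) 1, ∃ θ ∈ Ioo θ₀ θ₁, Φ w = E (s, θ)} with hI
  have hIo : IsOpen I := by
    refine isOpen_iff_eventually.2 ?_
    rintro w ⟨hwV, s, hs, θ, hθ, hw⟩
    obtain ⟨p, c, hwp, had⟩ := hE.exists_isAdapted (hΦ w hwV) hs (Ioo_subset_Icc_self hθ) hw
    rw [← interior_Icc] at hθ
    have := had.eventually hθ
    rw [← hwp] at this
    filter_upwards [this, hV.mem_nhds hwV] with v hv hvV
    obtain ⟨σ, ϑ, hϑ, h1, h2⟩ := hv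
    rw [interior_Icc] at hϑ
    exact ⟨hvV, σ, h2.2.1, ϑ, hϑ, by rw [h1, h2.eq]⟩
  -- `F` is the set of points sent to an edge. It is exhausted by closed pieces with values in
  -- compact parts of the cone, so Baire's theorem finds a point of `F` near which all of `F` goes
  -- to a single compact part.
  set F : Set ℂ := V ∩ Iᶜ with hF
  by_contra hcon
  push Not at hcon
  obtain ⟨w₀, hw₀, hcon⟩ := hcon
  have hw₀F : w₀ ∈ F := ⟨hw₀, fun h => by
    obtain ⟨-, s, hs, θ, hθ, h⟩ := h
    exact hcon s hs θ hθ h⟩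
  have hGδ : IsGδ F := hV.isGδ.inter hIo.isClosed_compl.isGδ
  have hBaire : BaireSpace F := hGδ.baireSpace_of_t2Space_locallyCompactSpace
  have hne : Nonempty F := ⟨⟨w₀, hw₀F⟩⟩
  have hΦF : Continuous fun w : F => Φ w := continuous_iff_continuousAt.2 fun w =>
    (hΦ w w.2.1).continuousAt.comp continuousAt_subtype_val
  have hrn : ∀ n : ℕ, 1 - 1 / ((n : ℝ) + 1) < 1 := fun n => by
    have : 0 < 1 / ((n : ℝ) + 1) := by positivity
    linarith
  obtain ⟨n, ⟨z, hzF⟩, hzn⟩ : ∃ n : ℕ, (interior {w : F | Φ w ∈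
      E '' (Icc 0 (1 - 1 / ((n : ℝ) + 1)) ×ˢ Icc θ₀ θ₁)}).Nonempty := by
    refine nonempty_interior_of_iUnion_of_closed (fun n => ?_) ?_
    · refine IsClosed.preimage hΦF ?_
      refine ((isCompact_Icc.prod isCompact_Icc).image_of_continuousOn
        (hE.continuousOn.mono ?_)).isClosed
      exact prod_mono (fun _ h => ⟨h.1, h.2.trans_lt (hrn n)⟩) subset_rfl
    · refine eq_univ_of_forall fun w => ?_
      obtain ⟨s, hs, θ, hθ, h⟩ := hVE w w.2.1
      obtain ⟨n, hn⟩ := exists_nat_one_div_lt (sub_pos.2 hs.2)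
      exact mem_iUnion.2 ⟨n, (s, θ), ⟨⟨hs.1.le, by linarith⟩, hθ⟩, h.symm⟩
  set r := 1 - 1 / ((n : ℝ) + 1) with hrdef
  have hr := hrn n
  have hzV := hzF.1
  have hnear : ∀ᶠ w in 𝓝 z, w ∈ F → Φ w ∈ E '' (Icc 0 r ×ˢ Icc θ₀ θ₁) := by
    have h1 := mem_interior_iff_mem_nhds.1 hzn
    rw [nhds_subtype_eq_comap] at h1
    obtain ⟨N, hN, hNsub⟩ := h1
    filter_upwards [hN] with w hw hwF
    exact @hNsub ⟨w, hwF⟩ hw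
  obtain ⟨s, hs, θ, hθ, hz⟩ := hVE z hzV
  have hedge : θ = θ₀ ∨ θ = θ₁ := by
    by_contra h
    push Not at h
    exact hzF.2 ⟨hzV, s, hs, θ, ⟨hθ.1.lt_of_ne' h.1, hθ.2.lt_of_ne h.2⟩, hz⟩
  obtain ⟨g, hg1, hg⟩ : ∃ g : ℝ, (g = 1 ∨ g = -1) ∧ ∀ ϑ ∈ Icc θ₀ θ₁, 0 ≤ g * (ϑ - θ) := by
    rcases hedge with rfl | rfl
    · exact ⟨1, Or.inl rfl, fun ϑ h => by linarith [h.1]⟩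
    · exact ⟨-1, Or.inr rfl, fun ϑ h => by linarith [h.2]⟩
  have hgg : g * g = 1 := by rcases hg1 with rfl | rfl <;> norm_num
  obtain ⟨p, c, hzp, had⟩ := hE.exists_isAdapted (hΦ z hzV) hs hθ hz
  have hside := hE.eventually_mem_side hinj hg hg1 had (hzp ▸ hΦ z hzV) hr
  rw [← hzp] at hside
  obtain ⟨η, hη, hball⟩ := Metric.eventually_nhds_iff_ball.1
    (hnear.and (hside.and (hV.eventually_mem hzV)))
  have hline : ∀ᶠ σ : ℝ in 𝓝 s, IsAdapted Φ E 0 (Icc θ₀ θ₁) p c σ θ ∧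
      p + c * conePoint 0 (σ, θ) ∈ Metric.ball z η := by
    refine had.eventually_radial.and ?_
    have h1 : Continuous fun σ : ℝ => p + c * conePoint 0 (σ, θ) := by
      have := continuous_conePoint 0
      fun_prop
    have h2 := h1.tendsto s
    rw [← hzp] at h2
    exact h2 (Metric.ball_mem_nhds z hη)
  obtain ⟨δ, hδ, hline⟩ := Metric.eventually_nhds_iff.1 hline
  -- `R` is the half-disc on the wrong side of the edge. A point of `F` in it would have its value
  -- in the compact part and hence lie on the right side, so `R` maps to the interior of the cone.
  -- Being convex, it sees one apex `p'` and one scale `c'`.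
  set R : Set ℂ := {w | w ∈ Metric.ball z η ∧
    g * ((w - p) * Complex.exp (-(θ * Complex.I))).im < 0} with hR
  have hRV : R ⊆ V := fun w hw => (hball w hw.1).2.2
  have hRI : ∀ w ∈ R, w ∈ I := by
    intro w hw
    by_contra hwI
    have h1 := hball w hw.1
    exact absurd (h1.2.1 (h1.1 ⟨h1.2.2, hwI⟩)) (not_le.2 hw.2)
  have hRc : Convex ℝ R := by
    refine (convex_ball z η).inter ?_
    intro v hv w hw a b ha hb hab
    have hv' : g * ((v - p) * Complex.exp (-(θ * Complex.I))).im < 0 := hv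
    have hw' : g * ((w - p) * Complex.exp (-(θ * Complex.I))).im < 0 := hw
    show g * ((a • v + b • w - p) * Complex.exp (-(θ * Complex.I))).im < 0
    have habC : (a : ℂ) + b = 1 := by exact_mod_cast hab
    have h1 : (a • v + b • w - p) * Complex.exp (-(θ * Complex.I)) =
        a * ((v - p) * Complex.exp (-(θ * Complex.I))) +
        b * ((w - p) * Complex.exp (-(θ * Complex.I))) := by
      simp only [Complex.real_smul]
      linear_combination (p * Complex.exp (-(θ * Complex.I))) * habC
    rw [h1, Complex.add_im, Complex.im_ofReal_mul, Complex.im_ofReal_mul]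
    rcases ha.eq_or_lt with rfl | ha
    · rw [zero_add] at hab
      subst hab
      linarith
    · nlinarith
  obtain ⟨p', c', hR'⟩ := hE.exists_apex hRc.isPreconnected (fun w hw => hΦ w (hRV hw))
    (fun w hw => by
      rw [interior_Icc]
      exact (hRI w hw).2)
  have hnorm : ∀ w ∈ R, ∃ s ∈ Ioo (0 : ℝ) 1, ∃ θ ∈ Icc θ₀ θ₁, Φ w = E (s, θ) ∧
      ‖w - p'‖ = c' * s ∧ 0 < c' := by
    intro w hw
    obtain ⟨c, s, θ, h1, h2, h3⟩ := hR' w hw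
    obtain rfl := h3 rfl
    refine ⟨s, h2.2.1, θ, h2.2.2.1, by rw [h1, h2.eq], ?_, h2.1⟩
    rw [h1, add_sub_cancel_left, norm_mul, norm_conePoint_zero h2.2.1.1.le, Complex.norm_real,
      Real.norm_of_nonneg h2.1.le]
  -- On `R` the distance to `p'` is `c' s`. At the edge `s` must tend to `1`, because compact parts
  -- lie on the right side. So a straight piece of edge would lie on the circle of radius `c'` about
  -- `p'`.
  refine false_of_norm_eq_on_interval (p := p) (p' := p') (u := conePoint 0 (1, θ)) (c := c)
    (r := c') (s := s) (δ := δ) had.1 hδ (conePoint_ne_zero one_ne_zero) fun σ hσ => ?_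
  obtain ⟨hadσ, hσb⟩ := hline (by rwa [Real.dist_eq])
  rw [← conePoint_eq_mul]
  set y : ℂ := p + c * conePoint 0 (σ, θ) with hy
  have hyR : y ∈ closure R := by
    have hlim : Tendsto (fun t : ℝ => y - (g * t : ℝ) * (Complex.I * Complex.exp (θ * Complex.I)))
        (𝓝[>] 0) (𝓝 y) := by
      have h1 : Continuous fun t : ℝ =>
        y - (g * t : ℝ) * (Complex.I * Complex.exp (θ * Complex.I)) := by fun_prop
      have h2 := h1.tendsto 0
      simp only [mul_zero, Complex.ofReal_zero, zero_mul, sub_zero] at h2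
      exact h2.mono_left nhdsWithin_le_nhds
    refine mem_closure_of_tendsto hlim ?_
    filter_upwards [hlim (Metric.isOpen_ball.mem_nhds hσb), self_mem_nhdsWithin] with t ht ht0
    refine ⟨ht, ?_⟩
    have h1 : (y - (g * t : ℝ) * (Complex.I * Complex.exp (θ * Complex.I)) - p) *
        Complex.exp (-(θ * Complex.I)) = ((c * σ : ℝ) : ℂ) - ((g * t : ℝ) : ℂ) * Complex.I := by
      have h2 : Complex.exp (θ * Complex.I) * Complex.exp (-(θ * Complex.I)) = 1 := by
        rw [← Complex.exp_add]
        simp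
      rw [hy, conePoint_eq]
      simp only [Complex.ofReal_zero, mul_zero, Complex.exp_zero, one_mul]
      push_cast
      linear_combination (c * σ - g * t * Complex.I) * h2
    rw [h1, Complex.sub_im, Complex.ofReal_im, Complex.im_ofReal_mul, Complex.I_im]
    have : 0 < t := ht0
    nlinarith
  have hyn : (𝓝[R] y).NeBot := mem_closure_iff_nhdsWithin_neBot.1 hyR
  have hyt : Tendsto (fun w => ‖w - p'‖) (𝓝[R] y) (𝓝 ‖y - p'‖) :=
    ((by fun_prop : Continuous fun w : ℂ => ‖w - p'‖).tendsto y).mono_left nhdsWithin_le_nhds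
  obtain ⟨w₁, hw₁⟩ := closure_nonempty_iff.1 ⟨y, hyR⟩
  obtain ⟨-, -, -, -, -, -, hc'⟩ := hnorm w₁ hw₁
  have hle : ‖y - p'‖ ≤ c' := by
    refine le_of_tendsto hyt ?_
    filter_upwards [self_mem_nhdsWithin] with w hw
    obtain ⟨s, hs, -, -, -, h, -⟩ := hnorm w hw
    rw [h]
    nlinarith [hs.2]
  refine hle.antisymm (not_lt.1 fun hlt => ?_)
  obtain ⟨m, hm1, hm2⟩ := exists_between hlt
  -- If `‖y - p'‖ < c'`, points of `R` near `y` have cone radius at most `m / c' < 1`. Their values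
  -- lie in a compact part of the cone, which puts them on the right side of the edge.
  have hm : m / c' < 1 := (div_lt_one hc').2 hm2
  have hside' := hE.eventually_mem_side hinj hg hg1 hadσ (hΦ y (hball y hσb).2.2) hm
  rw [← hy] at hside'
  obtain ⟨w, h1, h2, hwR⟩ := ((hyt.eventually_lt_const hm1).and
    ((hside'.filter_mono nhdsWithin_le_nhds).and self_mem_nhdsWithin)).exists
  obtain ⟨s', hs', θ', hθ', h3, h4, -⟩ := hnorm w hwR
  refine absurd (h2 ⟨(s', θ'), ⟨⟨hs'.1.le, ?_⟩, hθ'⟩, h3.symm⟩) (not_le.2 hwR.2)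
  rw [le_div_iff₀ hc', mul_comm, ← h4]
  exact h1.le

end DilationAtlas

/-! ### Neighbourhoods of singularities, and immersions of the plane. -/

namespace DilationSurface

variable {X : Type*} [TopologicalSpace X] [T2Space X]
variable {S : DilationSurface X} {Φ : ℂ → X} {x : X}

/-- Each singularity has a neighbourhood into which no set containing rays from all points can be
immersed, and that the plane cannot enter. -/
theorem exists_cone_nhd (hx : x ∈ S.sing) : ∃ N, IsOpen N ∧ x ∈ N ∧
    (∀ (Φ : ℂ → X) (V : Set ℂ), IsOpen V → IsPreconnected V →
      (∀ p : ℂ, ∃ v : ℂ, ∀ l : ℝ, 1 ≤ l → p + l * v ∈ V) →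
      (∀ w ∈ V, S.ImmersedAt Φ w) → ¬ MapsTo Φ V N) ∧
    ∀ (Φ : ℂ → X) (z : ℂ), (∀ w, S.ImmersedAt Φ w) → Φ z ∉ N := by
  have main : ∀ {τ : ℝ} {Θ : Set ℝ} {E : ℝ × ℝ → X}, S.IsConeChart x τ Θ E → Θ.Nonempty →
      (∀ (Φ : ℂ → X) (V : Set ℂ), IsOpen V → (∀ w ∈ V, S.ImmersedAt Φ w) →
        (∀ w ∈ V, ∃ s ∈ Ioo (0 : ℝ) 1, ∃ θ ∈ Θ, Φ w = E (s, θ)) →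
        ∀ w ∈ V, ∃ s ∈ Ioo (0 : ℝ) 1, ∃ θ ∈ interior Θ, Φ w = E (s, θ)) →
      ∃ N, IsOpen N ∧ x ∈ N ∧
      (∀ (Φ : ℂ → X) (V : Set ℂ), IsOpen V → IsPreconnected V →
        (∀ p : ℂ, ∃ v : ℂ, ∀ l : ℝ, 1 ≤ l → p + l * v ∈ V) →
        (∀ w ∈ V, S.ImmersedAt Φ w) → ¬ MapsTo Φ V N) ∧
      ∀ (Φ : ℂ → X) (z : ℂ), (∀ w, S.ImmersedAt Φ w) → Φ z ∉ N := by
    intro τ Θ E hE hΘ hint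
    obtain ⟨ϑ, hϑ⟩ := hΘ
    have hreg : ∀ (Φ : ℂ → X) (w : ℂ), S.ImmersedAt Φ w → Φ w ∈ E '' (Ico 0 1 ×ˢ Θ) →
        ∃ s ∈ Ioo (0 : ℝ) 1, ∃ θ ∈ Θ, Φ w = E (s, θ) := by
      rintro Φ w hw ⟨⟨s, θ⟩, ⟨hs, hθ⟩, h⟩
      refine ⟨s, ⟨hs.1.lt_of_ne fun h0 => ?_, hs.2⟩, θ, hθ, h.symm⟩
      have hs0 : s = 0 := h0.symm
      rw [hs0, hE.apex θ hθ] at h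
      exact hw.notMem_sing (h ▸ hx)
    refine ⟨_, hE.isOpen, ⟨(0, ϑ), ⟨by simp, hϑ⟩, hE.apex ϑ hϑ⟩, ?_, ?_⟩
    · intro Φ V hV hVp hray hΦ hmap
      have h1 := hint Φ V hV hΦ fun w hw => hreg Φ w (hΦ w hw) (hmap hw)
      obtain ⟨p, c₀, hp⟩ := hE.exists_apex hVp hΦ h1
      obtain ⟨v, hv⟩ := hray p
      refine hE.not_forall_ray (Φ := Φ) (p := p) (v := v) fun l hl => ?_
      obtain ⟨c, s, θ, h2, h3, -⟩ := hp _ (hv l hl)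
      exact ⟨c, s, θ, h2, h3⟩
    · intro Φ z hΦ hz
      obtain ⟨s, hs, θ, hθ, h⟩ := hreg Φ z (hΦ z) hz
      exact hE.false_of_plane hx hΦ hs hθ h
  rcases S.cone_model x hx with ⟨k, ρ, h⟩ | ⟨θ₀, α, h⟩
  · obtain ⟨τ, E, hE⟩ := h.exists_isConeChart
    exact main hE univ_nonempty fun Φ V _ _ h => by simpa using h
  · have hα := h.1
    obtain ⟨E, hE, hinj⟩ := h.exists_isConeChart
    refine main hE (nonempty_Icc.2 (by linarith)) fun Φ V hV hΦ h => ?_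
    rw [interior_Icc]
    exact hE.mem_interior_of_immersed hinj hV hΦ h

/-- If the plane is immersed in `X`, then `X` is a translation surface without singularities. -/
theorem isTranslation_of_plane [ConnectedSpace X] (hΦ : ∀ w, S.ImmersedAt Φ w) :
    S.IsTranslation ∧ S.sing = ∅ := by
  have hopen : IsOpen (range Φ) := by
    refine isOpen_iff_mem_nhds.2 ?_
    rintro _ ⟨z, rfl⟩
    have := (hΦ z).image_mem_nhds univ_mem
    rwa [image_univ] at this
  have hclosed : IsClosed (range Φ) := by
    refine isClosed_of_closure_subset fun x hx => ?_
    by_cases hxs : x ∈ S.sing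
    · obtain ⟨N, hN, hxN, -, hN'⟩ := exists_cone_nhd hxs
      obtain ⟨_, hyN, z, rfl⟩ := mem_closure_iff.1 hx N hN hxN
      exact absurd hyN (hN' Φ z hΦ)
    -- Near a regular limit point `x` the immersion can be continued until it takes the value `x`,
    -- since the whole plane is available. Hence the range is closed.
    · obtain ⟨e, he, hxe⟩ := S.cover x hxs
      obtain ⟨r, hr, hrad⟩ := (S.flat_target e he).exists_radius (e.map_source hxe)
      have hnb : e.source ∩ e ⁻¹' Metric.ball (e x) r ∈ 𝓝 x := by
        have h1 := (S.isOpen_source e he).mem_nhds hxe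
        exact inter_mem h1 (((S.continuousOn_chart e he).continuousAt h1)
          (Metric.ball_mem_nhds _ hr))
      obtain ⟨_, ⟨hys, hyb⟩, z, rfl⟩ := mem_closure_iff_nhds.1 hx _ hnb
      obtain ⟨a, ha⟩ := (hΦ z).exists_hasScaleAt he hys
      have ha0 : (a : ℂ) ≠ 0 := by exact_mod_cast ha.1.ne'
      have hw : e (Φ z) + a * (z + (e x - e (Φ z)) / a - z) = e x := by
        field_simp
        ring
      obtain ⟨h1, h2⟩ := ha.continuation convex_univ (fun w _ => hΦ w) he (mem_univ z) hrad hyb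
        (mem_univ (z + (e x - e (Φ z)) / a)) (by rw [hw]; exact Metric.mem_ball_self hr)
      exact ⟨_, e.injOn h1.2.1 hxe (h2.trans hw)⟩
  have huniv : range Φ = univ := IsClopen.eq_univ ⟨hclosed, hopen⟩ ⟨Φ 0, mem_range_self 0⟩
  refine ⟨DilationAtlas.isTranslation_of_range_eq_univ hΦ huniv, ?_⟩
  refine eq_empty_of_forall_notMem fun x hx => ?_
  obtain ⟨z, rfl⟩ : x ∈ range Φ := huniv ▸ mem_univ x
  exact (hΦ z).notMem_sing hx

end DilationSurface

/-! ### Plane geometry of convex cones. -/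

/-- The open convex cone of the `z` such that `|Im (z / u)| < δ Re (z / u)`. -/
def openCone (u : Circle) (δ : ℝ) : Set ℂ :=
  {z | |(z * (starRingEnd ℂ) (u : ℂ)).im| < δ * (z * (starRingEnd ℂ) (u : ℂ)).re}

theorem mem_openCone {u : Circle} {δ : ℝ} {z : ℂ} : z ∈ openCone u δ ↔
    |(z * (starRingEnd ℂ) (u : ℂ)).im| < δ * (z * (starRingEnd ℂ) (u : ℂ)).re := Iff.rfl

theorem isOpen_openCone (u : Circle) (δ : ℝ) : IsOpen (openCone u δ) :=
  isOpen_lt (by fun_prop) (by fun_prop)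

theorem smul_mem_openCone {u : Circle} {δ t : ℝ} {z : ℂ} (ht : 0 < t) (hz : z ∈ openCone u δ) :
    (t : ℂ) * z ∈ openCone u δ := by
  rw [mem_openCone] at hz ⊢
  rw [mul_assoc, Complex.im_ofReal_mul, Complex.re_ofReal_mul, abs_mul, abs_of_pos ht]
  nlinarith

theorem add_mem_openCone {u : Circle} {δ : ℝ} {z w : ℂ} (hz : z ∈ openCone u δ)
    (hw : w ∈ openCone u δ) : z + w ∈ openCone u δ := by
  rw [mem_openCone] at hz hw ⊢
  rw [add_mul, Complex.add_im, Complex.add_re]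
  have := abs_add_le (z * (starRingEnd ℂ) (u : ℂ)).im (w * (starRingEnd ℂ) (u : ℂ)).im
  linarith

theorem convex_openCone (u : Circle) (δ : ℝ) : Convex ℝ (openCone u δ) := by
  intro z hz w hw a b ha hb hab
  rcases ha.eq_or_lt with rfl | ha
  · rw [zero_add] at hab
    subst hab
    simpa using hw
  rcases hb.eq_or_lt with rfl | hb
  · rw [add_zero] at hab
    subst hab
    simpa using hz
  simp only [Complex.real_smul]
  exact add_mem_openCone (smul_mem_openCone ha hz) (smul_mem_openCone hb hw)

theorem re_pos_of_mem_openCone {u : Circle} {δ : ℝ} (hδ : 0 < δ) {z : ℂ} (hz : z ∈ openCone u δ) :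
    0 < (z * (starRingEnd ℂ) (u : ℂ)).re := by
  rw [mem_openCone] at hz
  exact pos_of_mul_pos_right ((abs_nonneg _).trans_lt hz) hδ.le

theorem ne_zero_of_mem_openCone {u : Circle} {δ : ℝ} {z : ℂ} (hz : z ∈ openCone u δ) : z ≠ 0 := by
  rintro rfl
  simp [mem_openCone] at hz

theorem openCone_mono {u : Circle} {δ δ' : ℝ} (hδ : 0 < δ) (h : δ ≤ δ') :
    openCone u δ ⊆ openCone u δ' := fun z hz => by
  have := re_pos_of_mem_openCone hδ hz
  rw [mem_openCone] at hz ⊢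
  nlinarith

theorem circle_mul_conj (u : Circle) : (u : ℂ) * (starRingEnd ℂ) (u : ℂ) = 1 := by
  rw [Complex.mul_conj, Circle.normSq_coe, Complex.ofReal_one]

theorem real_mul_circle_mem_openCone {u : Circle} {δ r : ℝ} (hδ : 0 < δ) (hr : 0 < r) :
    (r : ℂ) * (u : ℂ) ∈ openCone u δ := by
  rw [mem_openCone, mul_assoc, circle_mul_conj]
  simpa using mul_pos hδ hr

theorem exists_eq_real_mul_circle {v : ℂ} (hv : v ≠ 0) :
    ∃ (r : ℝ) (d : Circle), 0 < r ∧ v = (r : ℂ) * (d : ℂ) := by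
  refine ⟨‖v‖, Circle.exp v.arg, norm_pos_iff.2 hv, ?_⟩
  rw [Circle.coe_exp, Complex.norm_mul_exp_arg_mul_I]

/-- The distance from `u` to `z` divided by its component along `u`. -/
theorem norm_sub_circle_of_re_eq {u : Circle} {z : ℂ}
    (hx : (z * (starRingEnd ℂ) (u : ℂ)).re ≠ 0) :
    ‖((z * (starRingEnd ℂ) (u : ℂ)).re : ℂ)⁻¹ * z - u‖ =
      |(z * (starRingEnd ℂ) (u : ℂ)).im| / |(z * (starRingEnd ℂ) (u : ℂ)).re| := by
  set ζ := z * (starRingEnd ℂ) (u : ℂ) with hζ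
  have hz : z = ζ * u := by
    rw [hζ, mul_assoc, mul_comm _ (u : ℂ), circle_mul_conj, mul_one]
  have hxC : (ζ.re : ℂ) ≠ 0 := by exact_mod_cast hx
  have : (ζ.re : ℂ)⁻¹ * z - u = ((ζ.im / ζ.re : ℝ) : ℂ) * Complex.I * u := by
    rw [hz]
    nth_rewrite 2 [← Complex.re_add_im ζ]
    push_cast
    field_simp
    ring
  rw [this]
  simp [Circle.norm_coe]

/-- By invariance under dilations it suffices to normalize the component along `u` to `1` and use a
disc around `u`. The non-strict inequality on the imaginary part provides closed cones for
compactness arguments. -/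
theorem exists_openCone_subset {u : Circle} {O : Set ℂ} (hO : O ∈ 𝓝 (u : ℂ))
    (hsmul : ∀ (t : ℝ) (z : ℂ), 0 < t → z ∈ O → (t : ℂ) * z ∈ O) :
    ∃ δ > 0, ∀ z : ℂ, 0 < (z * (starRingEnd ℂ) (u : ℂ)).re →
      |(z * (starRingEnd ℂ) (u : ℂ)).im| ≤ δ * (z * (starRingEnd ℂ) (u : ℂ)).re → z ∈ O := by
  obtain ⟨ρ, hρ, hball⟩ := Metric.mem_nhds_iff.1 hO
  refine ⟨ρ / 2, by positivity, fun z hre him => ?_⟩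
  have h1 : ((z * (starRingEnd ℂ) (u : ℂ)).re : ℂ)⁻¹ * z ∈ O := by
    refine hball ?_
    rw [Metric.mem_ball, dist_eq_norm, norm_sub_circle_of_re_eq hre.ne', abs_of_pos hre,
      div_lt_iff₀ hre]
    nlinarith
  have h2 := hsmul _ _ hre h1
  have hC : ((z * (starRingEnd ℂ) (u : ℂ)).re : ℂ) ≠ 0 := by exact_mod_cast hre.ne'
  rwa [mul_inv_cancel_left₀ hC] at h2

theorem norm_le_re_add_im {u : Circle} {z : ℂ} :
    ‖z‖ ≤ |(z * (starRingEnd ℂ) (u : ℂ)).re| + |(z * (starRingEnd ℂ) (u : ℂ)).im| := by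
  have h := Complex.norm_le_abs_re_add_abs_im (z * (starRingEnd ℂ) (u : ℂ))
  rwa [norm_mul, Complex.norm_conj, Circle.norm_coe, mul_one] at h

/-- A bounded open sector given by a convex cone. -/
def coneSector (u : Circle) (δ ε : ℝ) : Set ℂ := openCone u δ ∩ Metric.ball 0 ε

theorem isOpen_coneSector (u : Circle) (δ ε : ℝ) : IsOpen (coneSector u δ ε) :=
  (isOpen_openCone u δ).inter Metric.isOpen_ball

theorem convex_coneSector (u : Circle) (δ ε : ℝ) : Convex ℝ (coneSector u δ ε) :=
  (convex_openCone u δ).inter (convex_ball 0 ε)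

theorem exists_smul_mem_coneSector {u : Circle} {δ ε : ℝ} {z : ℂ} (hε : 0 < ε)
    (hz : z ∈ openCone u δ) : ∃ t₀ > 0, ∀ t : ℝ, 0 < t → t < t₀ → (t : ℂ) * z ∈ coneSector u δ ε := by
  have hn : 0 < ‖z‖ := norm_pos_iff.2 (ne_zero_of_mem_openCone hz)
  refine ⟨ε / ‖z‖, by positivity, fun t ht ht' => ⟨smul_mem_openCone ht hz, ?_⟩⟩
  rw [mem_ball_zero_iff, norm_mul, Complex.norm_real, Real.norm_of_nonneg ht.le]
  rwa [lt_div_iff₀ hn] at ht'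

/-- A first point of a cone outside an open set containing a sector, seen from a convex set. -/
theorem exists_touching_point {u : Circle} {δ ε : ℝ} (hε : 0 < ε) {D : Set ℂ} (hD : IsOpen D)
    (hPD : coneSector u δ ε ⊆ D) {z₁ : ℂ} (hz₁ : z₁ ∈ openCone u δ) (hz₁D : z₁ ∉ D) :
    ∃ z ∈ openCone u δ, z ∉ D ∧ ∃ G ⊆ D, IsOpen G ∧ Convex ℝ G ∧
      (∀ t : ℝ, 0 < t → t < 1 → (t : ℂ) * z ∈ G) ∧ G ⊆ openCone u δ := by
  obtain ⟨r, d, hr, hrd⟩ := exists_eq_real_mul_circle (ne_zero_of_mem_openCone hz₁)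
  have hdK : (d : ℂ) ∈ openCone u δ := by
    have := smul_mem_openCone (inv_pos.2 hr) hz₁
    have hrC : (r : ℂ) ≠ 0 := by exact_mod_cast hr.ne'
    rwa [hrd, Complex.ofReal_inv, inv_mul_cancel_left₀ hrC] at this
  obtain ⟨δ₁, hδ₁, hsub⟩ := exists_openCone_subset ((isOpen_openCone u δ).mem_nhds hdK)
    fun t z ht hz => smul_mem_openCone ht hz
  set X : ℂ → ℝ := fun z => (z * (starRingEnd ℂ) (d : ℂ)).re with hX
  set Y : ℂ → ℝ := fun z => (z * (starRingEnd ℂ) (d : ℂ)).im with hY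
  have hXc : Continuous X := by fun_prop
  have hYc : Continuous Y := by fun_prop
  have hXadd : ∀ z w, X (z + w) = X z + X w := fun z w => by simp only [hX, add_mul, Complex.add_re]
  have hYadd : ∀ z w, Y (z + w) = Y z + Y w := fun z w => by simp only [hY, add_mul, Complex.add_im]
  have hXmul : ∀ (t : ℝ) z, X (t * z) = t * X z := fun t z => by
    simp only [hX, mul_assoc, Complex.re_ofReal_mul]
  have hYmul : ∀ (t : ℝ) z, Y (t * z) = t * Y z := fun t z => by
    simp only [hY, mul_assoc, Complex.im_ofReal_mul]
  have hX₁ : X z₁ = r := by simp only [hX, hrd, mul_assoc, circle_mul_conj]; simp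
  have hY₁ : Y z₁ = 0 := by simp only [hY, hrd, mul_assoc, circle_mul_conj]; simp
  have hnorm : ∀ z, ‖z‖ ≤ |X z| + |Y z| := fun z => norm_le_re_add_im
  -- `C` is chosen so that `f > r` on the sides `|Y| = δ₁ X` outside the disc of radius `ε / 2`. A
  -- minimizer with `f ≤ r` is therefore off the sides.
  set C : ℝ := r * (2 * (1 + δ₁)) / (ε * δ₁) with hC
  have hC0 : 0 < C := by positivity
  set f : ℂ → ℝ := fun z => X z + C * |Y z| with hf
  have hfc : Continuous f := by fun_prop
  -- The missing points in a closed subcone. The condition `ε / 2 ≤ ‖z‖` keeps the apex away and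
  -- costs nothing, since missing points of the cone have norm at least `ε`.
  set A : Set ℂ := {z | |Y z| ≤ δ₁ * X z} ∩ {z | f z ≤ r} ∩ {z | ε / 2 ≤ ‖z‖} ∩ Dᶜ with hA
  have hAcl : IsClosed A := by
    refine ((IsClosed.inter ?_ ?_).inter ?_).inter hD.isClosed_compl
    · exact isClosed_le (by fun_prop) (by fun_prop)
    · exact isClosed_le hfc continuous_const
    · exact isClosed_le continuous_const continuous_norm
  have hX0 : ∀ z, |Y z| ≤ δ₁ * X z → 0 ≤ X z := fun z hz =>
    nonneg_of_mul_nonneg_right ((abs_nonneg _).trans hz) hδ₁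
  have hnorm' : ∀ z, |Y z| ≤ δ₁ * X z → ‖z‖ ≤ (1 + δ₁) * X z := fun z hz => by
    have h1 := hnorm z
    rw [abs_of_nonneg (hX0 z hz)] at h1
    linarith
  have hfX : ∀ z, X z ≤ f z := fun z => by
    have : 0 ≤ C * |Y z| := by positivity
    simp only [hf]
    linarith
  have hAcomp : IsCompact A := by
    refine Metric.isCompact_of_isClosed_isBounded hAcl
      ((Metric.isBounded_closedBall (x := (0 : ℂ)) (r := (1 + δ₁) * r)).subset ?_)
    rintro z ⟨⟨⟨h1, h2⟩, -⟩, -⟩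
    rw [mem_closedBall_zero_iff]
    refine (hnorm' z h1).trans ?_
    have h3 : X z ≤ r := (hfX z).trans h2
    gcongr
  have hball : ∀ z ∈ openCone u δ, z ∉ D → ε ≤ ‖z‖ := fun z hz hzD => by
    by_contra h
    exact hzD (hPD ⟨hz, by rw [mem_ball_zero_iff]; linarith⟩)
  have hz₁A : z₁ ∈ A := by
    refine ⟨⟨⟨?_, ?_⟩, ?_⟩, hz₁D⟩
    · show |Y z₁| ≤ δ₁ * X z₁
      rw [hY₁, hX₁, abs_zero]
      positivity
    · show X z₁ + C * |Y z₁| ≤ r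
      rw [hY₁, hX₁]
      simp
    · have := hball z₁ hz₁ hz₁D
      show ε / 2 ≤ ‖z₁‖
      linarith
  obtain ⟨z, ⟨⟨⟨hzY, hzf⟩, hzn⟩, hzD⟩, hmin⟩ := hAcomp.exists_isMinOn ⟨z₁, hz₁A⟩ hfc.continuousOn
  replace hzY : |Y z| ≤ δ₁ * X z := hzY
  replace hzf : f z ≤ r := hzf
  replace hzn : ε / 2 ≤ ‖z‖ := hzn
  have hXz : 0 < X z := by
    have := hnorm' z hzY
    by_contra h
    nlinarith
  have hzY' : |Y z| < δ₁ * X z := by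
    refine hzY.lt_of_ne fun h => ?_
    have h1 : f z = X z + C * (δ₁ * X z) := by simp only [hf, h]
    have h2 : r ≤ C * (δ₁ * X z) := by
      have h3 : ε / 2 ≤ (1 + δ₁) * X z := hzn.trans (hnorm' z hzY)
      rw [hC, div_mul_eq_mul_div, le_div_iff₀ (by positivity)]
      nlinarith [mul_pos hr hδ₁]
    linarith
  -- By minimality of `f z`, this sublevel set contains no missing point. It is convex because `f`
  -- is, and it contains `t z` for `0 < t < 1` because `f` is positively homogeneous.
  refine ⟨z, hsub z hXz hzY, hzD, {w | |Y w| < δ₁ * X w ∧ f w < f z}, ?_, ?_, ?_, ?_, ?_⟩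
  · rintro w ⟨h1, h2⟩
    by_contra hwD
    have hXw : 0 < X w := pos_of_mul_pos_right ((abs_nonneg _).trans_lt h1) hδ₁.le
    have hwK : w ∈ openCone u δ := hsub w hXw h1.le
    have hwA : w ∈ A := ⟨⟨⟨h1.le, h2.le.trans hzf⟩, by
      have := hball w hwK hwD
      show ε / 2 ≤ ‖w‖
      linarith⟩, hwD⟩
    have := isMinOn_iff.1 hmin w hwA
    linarith
  · exact (isOpen_lt (f := fun w => |Y w|) (g := fun w => δ₁ * X w) (by fun_prop)
      (by fun_prop)).inter (isOpen_lt hfc continuous_const)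
  · rintro v ⟨hv1, hv2⟩ w ⟨hw1, hw2⟩ a b ha hb hab
    have hYab : |Y (a • v + b • w)| ≤ a * |Y v| + b * |Y w| := by
      simp only [Complex.real_smul, hYadd, hYmul]
      refine (abs_add_le _ _).trans ?_
      rw [abs_mul, abs_mul, abs_of_nonneg ha, abs_of_nonneg hb]
    have hXab : X (a • v + b • w) = a * X v + b * X w := by
      simp only [Complex.real_smul, hXadd, hXmul]
    have hf' : f (a • v + b • w) ≤ a * f v + b * f w := by
      simp only [hf, hXab]
      nlinarith
    rcases ha.eq_or_lt with rfl | ha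
    · rw [zero_add] at hab
      subst hab
      simpa using And.intro hw1 hw2
    · constructor
      · rw [hXab]
        nlinarith
      · refine hf'.trans_lt ?_
        have hb' : b = 1 - a := by linarith
        subst hb'
        nlinarith
  · intro t ht ht1
    refine ⟨?_, ?_⟩
    · rw [hYmul, hXmul, abs_mul, abs_of_pos ht]
      nlinarith
    · have h1 : f (t * z) = t * f z := by
        simp only [hf, hYmul, hXmul, abs_mul, abs_of_pos ht]
        ring
      have h2 := hfX z
      rw [h1]
      nlinarith
  · rintro w ⟨h1, -⟩
    exact hsub w (pos_of_mul_pos_right ((abs_nonneg _).trans_lt h1) hδ₁.le) h1.le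

/-! ### Maximal radial continuation. -/

namespace DilationAtlas

variable {X : Type*} [TopologicalSpace X]

/-- `Ψ` continues `φ` from `P` to the convex open set `V` along the segment from a multiple of `z`
to `z`. -/
def IsContinuation (S : DilationAtlas X) (φ : ℂ → X) (P : Set ℂ) (z : ℂ) (V : Set ℂ) (Ψ : ℂ → X) :
    Prop :=
  IsOpen V ∧ Convex ℝ V ∧ z ∈ V ∧ (∀ w ∈ V, S.ImmersedAt Ψ w) ∧
    ∃ t : ℝ, 0 < t ∧ t ≤ 1 ∧ (t : ℂ) * z ∈ V ∧ (t : ℂ) * z ∈ P ∧ Ψ =ᶠ[𝓝 ((t : ℂ) * z)] φ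

/-- The star-shaped domain to which `φ` can be continued radially. -/
def developDomain (S : DilationAtlas X) (φ : ℂ → X) (P : Set ℂ) : Set ℂ :=
  {z | ∃ V Ψ, S.IsContinuation φ P z V Ψ}

open Classical in
/-- The maximal radial continuation of `φ`. -/
def develop (S : DilationAtlas X) (φ : ℂ → X) (P : Set ℂ) (z : ℂ) : X :=
  if h : ∃ V Ψ, S.IsContinuation φ P z V Ψ then h.choose_spec.choose z else φ z

variable {S : DilationAtlas X} {φ Ψ : ℂ → X} {P V : Set ℂ} {z : ℂ}

theorem IsContinuation.eventually (hP : IsOpen P) (h : S.IsContinuation φ P z V Ψ) :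
    ∀ᶠ w in 𝓝 z, S.IsContinuation φ P w V Ψ := by
  obtain ⟨hVo, hVc, hz, hΨ, t, ht, ht1, htV, htP, heq⟩ := h
  have h1 : Tendsto (fun w : ℂ => (t : ℂ) * w) (𝓝 z) (𝓝 (t * z)) :=
    (by fun_prop : Continuous fun w : ℂ => (t : ℂ) * w).tendsto z
  filter_upwards [hVo.mem_nhds hz, h1.eventually (hVo.mem_nhds htV),
    h1.eventually (hP.mem_nhds htP), h1.eventually heq.eventually_nhds] with w h2 h3 h4 h5
  exact ⟨hVo, hVc, h2, hΨ, t, ht, ht1, h3, h4, h5⟩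

theorem isOpen_developDomain (hP : IsOpen P) : IsOpen (S.developDomain φ P) :=
  isOpen_iff_eventually.2 fun _ ⟨V, Ψ, h⟩ => (h.eventually hP).mono fun _ hw => ⟨V, Ψ, hw⟩

theorem isContinuation_self (hP : IsOpen P) (hPc : Convex ℝ P) (hφ : ∀ w ∈ P, S.ImmersedAt φ w)
    (hz : z ∈ P) : S.IsContinuation φ P z P φ :=
  ⟨hP, hPc, hz, hφ, 1, one_pos, le_rfl, by simpa using hz, by simpa using hz, EventuallyEq.rfl⟩

variable [T2Space X]

/-- Two continuations may start from different points `t z`, `t' z` of `P`. Both still agree with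
`φ` near `max t t' z`, by the identity principle on the convex sets `V ∩ P` and `V' ∩ P`; from there
they agree on `V ∩ V'`. -/
theorem IsContinuation.unique (hPc : Convex ℝ P) (hφ : ∀ w ∈ P, S.ImmersedAt φ w)
    (h : S.IsContinuation φ P z V Ψ) {V' : Set ℂ} {Ψ' : ℂ → X}
    (h' : S.IsContinuation φ P z V' Ψ') : Ψ z = Ψ' z := by
  have aux : ∀ {V : Set ℂ} {Ψ : ℂ → X} {t : ℝ}, Convex ℝ V → z ∈ V → (∀ w ∈ V, S.ImmersedAt Ψ w) →
      0 < t → t ≤ 1 → (t : ℂ) * z ∈ V → (t : ℂ) * z ∈ P → Ψ =ᶠ[𝓝 ((t : ℂ) * z)] φ →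
      ∀ m : ℝ, t ≤ m → m ≤ 1 → (m : ℂ) * z ∈ V ∧ ((m : ℂ) * z ∈ P → Ψ =ᶠ[𝓝 ((m : ℂ) * z)] φ) := by
    intro V Ψ t hV hz hΨ ht ht1 htV htP heq m htm hm1
    have hmV : (m : ℂ) * z ∈ V := by
      rcases ht1.eq_or_lt with rfl | ht1
      · obtain rfl : m = 1 := le_antisymm hm1 htm
        exact htV
      have h1 := hV htV hz (a := (1 - m) / (1 - t)) (b := (m - t) / (1 - t))
        (div_nonneg (by linarith) (by linarith)) (div_nonneg (by linarith) (by linarith))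
        (by rw [← add_div, div_eq_one_iff_eq (by linarith)]; ring)
      have hne : (1 : ℂ) - t ≠ 0 := by
        have : (1 : ℝ) - t ≠ 0 := by linarith
        exact_mod_cast this
      convert h1 using 1
      simp only [Complex.real_smul]
      push_cast
      field_simp
      ring
    exact ⟨hmV, fun hmP => eqOn_of_eventuallyEq (hV.inter hPc).isPreconnected
      (fun w hw => hΨ w hw.1) (fun w hw => hφ w hw.2) ⟨htV, htP⟩ heq _ ⟨hmV, hmP⟩⟩
  obtain ⟨-, hVc, hz, hΨ, t, ht, ht1, htV, htP, heq⟩ := h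
  obtain ⟨-, hVc', hz', hΨ', t', ht', ht1', htV', htP', heq'⟩ := h'
  have h1 := aux hVc hz hΨ ht ht1 htV htP heq (max t t') (le_max_left _ _) (max_le ht1 ht1')
  have h2 := aux hVc' hz' hΨ' ht' ht1' htV' htP' heq' (max t t') (le_max_right _ _) (max_le ht1 ht1')
  have hmP : ((max t t' : ℝ) : ℂ) * z ∈ P := by
    rcases max_choice t t' with h | h <;> rw [h] <;> assumption
  exact (eqOn_of_eventuallyEq (hVc.inter hVc').isPreconnected (fun w hw => hΨ w hw.1)
    (fun w hw => hΨ' w hw.2) ⟨h1.1, h2.1⟩ ((h1.2 hmP).trans (h2.2 hmP).symm) z ⟨hz, hz'⟩).eq_of_nhds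

theorem IsContinuation.develop_eq (hPc : Convex ℝ P) (hφ : ∀ w ∈ P, S.ImmersedAt φ w)
    (h : S.IsContinuation φ P z V Ψ) : S.develop φ P z = Ψ z := by
  have hex : ∃ V Ψ, S.IsContinuation φ P z V Ψ := ⟨V, Ψ, h⟩
  rw [develop, dif_pos hex]
  exact hex.choose_spec.choose_spec.unique hPc hφ h

theorem immersedAt_develop (hP : IsOpen P) (hPc : Convex ℝ P) (hφ : ∀ w ∈ P, S.ImmersedAt φ w)
    (hz : z ∈ S.developDomain φ P) : S.ImmersedAt (S.develop φ P) z := by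
  obtain ⟨V, Ψ, h⟩ := hz
  exact (h.2.2.2.1 z h.2.2.1).congr ((h.eventually hP).mono fun w hw => hw.develop_eq hPc hφ)

theorem subset_developDomain (hP : IsOpen P) (hPc : Convex ℝ P) (hφ : ∀ w ∈ P, S.ImmersedAt φ w) :
    P ⊆ S.developDomain φ P := fun _ hz => ⟨P, φ, isContinuation_self hP hPc hφ hz⟩

theorem develop_eq_of_mem (hP : IsOpen P) (hPc : Convex ℝ P) (hφ : ∀ w ∈ P, S.ImmersedAt φ w)
    (hz : z ∈ P) : S.develop φ P z = φ z :=
  (isContinuation_self hP hPc hφ hz).develop_eq hPc hφ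

end DilationAtlas

/-! ### Finite cluster sets, and discs near the tip of a convex set. -/

theorem exists_isOpen_nhd_of_clusterPt_mem {X α : Type*} [TopologicalSpace X] [CompactSpace X]
    [T2Space X] {F : Filter α} {f : α → X} {A : Set X} (hA : A.Finite)
    (hcl : ∀ y, ClusterPt y (map f F) → y ∈ A) {N : X → Set X} (hN : ∀ x ∈ A, N x ∈ 𝓝 x) :
    ∃ M : X → Set X, (∀ x ∈ A, IsOpen (M x) ∧ x ∈ M x ∧ M x ⊆ N x) ∧ A.PairwiseDisjoint M ∧
      ∀ᶠ a in F, f a ∈ ⋃ x ∈ A, M x := by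
  obtain ⟨U, hU, hdisj⟩ := hA.t2_separation
  have hM : ∀ x ∈ A, IsOpen (U x ∩ interior (N x)) ∧ x ∈ U x ∩ interior (N x) ∧
      U x ∩ interior (N x) ⊆ N x := fun x hx =>
    ⟨(hU x).2.inter isOpen_interior, ⟨(hU x).1, mem_interior_iff_mem_nhds.2 (hN x hx)⟩,
      inter_subset_right.trans interior_subset⟩
  refine ⟨fun x => U x ∩ interior (N x), hM, fun x hx y hy hxy =>
    (hdisj hx hy hxy).mono inter_subset_left inter_subset_left, ?_⟩
  -- Otherwise compactness gives a cluster point outside the chosen neighbourhoods of `A`.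
  by_contra hcon
  set O : Set X := ⋃ x ∈ A, U x ∩ interior (N x) with hO
  have hOo : IsOpen O := isOpen_biUnion fun x hx => (hM x hx).1
  have hne : (map f F ⊓ 𝓟 Oᶜ).NeBot := by
    rw [← frequently_mem_iff_neBot]
    exact frequently_map.2 (not_eventually.1 hcon)
  obtain ⟨y, hy⟩ := exists_clusterPt_of_compactSpace (map f F ⊓ 𝓟 Oᶜ)
  have hyA := hcl y (hy.mono inf_le_left)
  have hyO : y ∈ Oᶜ := by
    have h1 : ClusterPt y (𝓟 Oᶜ) := hy.mono inf_le_right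
    rw [← mem_closure_iff_clusterPt, hOo.isClosed_compl.closure_eq] at h1
    exact h1
  exact hyO (mem_biUnion hyA (hM y hyA).2.1)

theorem exists_mapsTo_of_mapsTo_biUnion {X α : Type*} [TopologicalSpace X] [TopologicalSpace α]
    {f : α → X} {A : Set X} {M : X → Set X} (hM : ∀ x ∈ A, IsOpen (M x))
    (hdisj : A.PairwiseDisjoint M) {V : Set α} (hV : IsPreconnected V) (hne : V.Nonempty)
    (hf : ContinuousOn f V) (hmaps : ∀ a ∈ V, f a ∈ ⋃ x ∈ A, M x) : ∃ x ∈ A, MapsTo f V (M x) := by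
  obtain ⟨v, hv⟩ := hne
  obtain ⟨x, hx, hvx⟩ := mem_iUnion₂.1 (hmaps v hv)
  refine ⟨x, hx, mapsTo_iff_image_subset.2 ?_⟩
  refine (hV.image f hf).subset_left_of_subset_union (hM x hx)
    (v := ⋃ y ∈ A \ {x}, M y) (isOpen_biUnion fun y hy => hM y hy.1) ?_ ?_ ⟨f v, ⟨v, hv, rfl⟩, hvx⟩
  · refine disjoint_iUnion₂_right.2 fun y hy => hdisj hx hy.1 fun h => hy.2 h.symm
  · rintro _ ⟨a, ha, rfl⟩
    obtain ⟨y, hy, hay⟩ := mem_iUnion₂.1 (hmaps a ha)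
    by_cases hyx : y = x
    · exact Or.inl (hyx ▸ hay)
    · exact Or.inr (mem_biUnion ⟨hy, hyx⟩ hay)

/-- The point `t z` is a convex combination of `z / 2`, with weight `2 - 2t`, and of `z` in the
closure of `G`. A disc around `z / 2` shrinks by that weight, so the room around `t z` is linear in
`1 - t`. -/
theorem Convex.exists_ball_smul_subset {G : Set ℂ} (hG : Convex ℝ G) (hGo : IsOpen G) {z : ℂ}
    (hz : ∀ t : ℝ, 0 < t → t < 1 → (t : ℂ) * z ∈ G) :
    ∃ κ > 0, ∀ t : ℝ, 1 / 2 ≤ t → t < 1 → Metric.ball ((t : ℂ) * z) (κ * (1 - t)) ⊆ G := by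
  have hcl : z ∈ closure G := by
    have h1 : Tendsto (fun t : ℝ => (t : ℂ) * z) (𝓝[<] 1) (𝓝 z) := by
      have h2 := (by fun_prop : Continuous fun t : ℝ => (t : ℂ) * z).tendsto 1
      simp only [Complex.ofReal_one, one_mul] at h2
      exact h2.mono_left nhdsWithin_le_nhds
    refine mem_closure_of_tendsto h1 ?_
    filter_upwards [Ioo_mem_nhdsLT one_pos] with t ht
    exact hz t ht.1 ht.2
  obtain ⟨κ, hκ, hball⟩ := Metric.isOpen_iff.1 hGo _ (hz (1 / 2) (by norm_num) (by norm_num))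
  refine ⟨2 * κ, by positivity, fun t ht ht1 w hw => ?_⟩
  have h0 : 0 < 2 - 2 * t := by linarith
  have h0C : (1 : ℂ) - t ≠ 0 := by exact_mod_cast (sub_pos.2 ht1).ne'
  have h1 : ((1 / 2 : ℝ) : ℂ) * z + (w - t * z) / ((2 - 2 * t : ℝ) : ℂ) ∈ G := by
    refine hball ?_
    rw [Metric.mem_ball, dist_eq_norm] at hw ⊢
    rw [add_sub_cancel_left, norm_div, Complex.norm_real, Real.norm_of_nonneg h0.le,
      div_lt_iff₀ h0]
    linarith
  have h2 := hG.combo_interior_closure_mem_interior (by rwa [hGo.interior_eq]) hcl h0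
    (b := 2 * t - 1) (by linarith) (by ring)
  rw [hGo.interior_eq] at h2
  convert h2 using 1
  simp only [Complex.real_smul]
  have h3 : (2 : ℂ) - 2 * t = 2 * (1 - t) := by ring
  push_cast
  rw [h3]
  field_simp
  ring

/-! ### Pencils that do not extend to the whole cone. -/

namespace DilationSurface

variable {X : Type*} [TopologicalSpace X]

/-- A pencil whose sector is a convex cone. -/
structure IsConePencil (S : DilationSurface X) (x₀ : X) (φ : ℂ → X) (u : Circle) (δ ε : ℝ) :
    Prop where
  δ_pos : 0 < δ
  ε_pos : 0 < ε
  tendsto : Tendsto φ (𝓝[coneSector u δ ε] 0) (𝓝 x₀)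
  immersed : ∀ z ∈ coneSector u δ ε, S.ImmersedAt φ z

/-- The set of points to which a pencil extends. -/
def domain (S : DilationSurface X) (φ : ℂ → X) (u : Circle) (δ ε : ℝ) : Set ℂ :=
  S.developDomain φ (coneSector u δ ε)

/-- The maximal extension of a pencil. -/
def extension (S : DilationSurface X) (φ : ℂ → X) (u : Circle) (δ ε : ℝ) : ℂ → X :=
  S.develop φ (coneSector u δ ε)

variable [T2Space X] {S : DilationSurface X} {x₀ : X} {φ : ℂ → X} {u : Circle} {δ ε : ℝ} {z : ℂ}

theorem IsConePencil.immersed_extension (h : S.IsConePencil x₀ φ u δ ε)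
    (hz : z ∈ S.domain φ u δ ε) : S.ImmersedAt (S.extension φ u δ ε) z :=
  DilationAtlas.immersedAt_develop (isOpen_coneSector u δ ε) (convex_coneSector u δ ε) h.immersed hz

theorem IsConePencil.extension_eq (h : S.IsConePencil x₀ φ u δ ε)
    (hz : z ∈ coneSector u δ ε) : S.extension φ u δ ε z = φ z :=
  DilationAtlas.develop_eq_of_mem (isOpen_coneSector u δ ε) (convex_coneSector u δ ε) h.immersed hz

theorem IsConePencil.trajectoryReaches (h : S.IsConePencil x₀ φ u δ ε) (hz : z ∈ openCone u δ)
    (hzD : ∀ t : ℝ, 0 < t → t < 1 → (t : ℂ) * z ∈ S.domain φ u δ ε) {q : X}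
    (hq : Tendsto (fun t : ℝ => S.extension φ u δ ε (t * z)) (𝓝[<] 1) (𝓝 q)) :
    ∃ d : Circle, (d : ℂ) ∈ openCone u δ ∧ S.TrajectoryReaches x₀ φ d q := by
  obtain ⟨T, d, hT, hzd⟩ := exists_eq_real_mul_circle (ne_zero_of_mem_openCone hz)
  have hTC : (T : ℂ) ≠ 0 := by exact_mod_cast hT.ne'
  have hdz : ∀ t : ℝ, (t : ℂ) * d = ((t / T : ℝ) : ℂ) * z := fun t => by
    rw [hzd]
    push_cast
    field_simp
  have hdK : (d : ℂ) ∈ openCone u δ := by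
    have h1 := smul_mem_openCone (inv_pos.2 hT) hz
    rwa [hzd, Complex.ofReal_inv, inv_mul_cancel_left₀ hTC] at h1
  set Φ := S.extension φ u δ ε with hΦ
  have hdD : ∀ t : ℝ, 0 < t → t < T → (t : ℂ) * d ∈ S.domain φ u δ ε := fun t ht htT => by
    rw [hdz]
    exact hzD _ (by positivity) ((div_lt_one hT).2 htT)
  obtain ⟨t₀, ht₀, hsmall⟩ := exists_smul_mem_coneSector h.ε_pos hdK
  have hφ0 : Tendsto (fun t : ℝ => φ (t * d)) (𝓝[>] 0) (𝓝 x₀) := by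
    refine h.tendsto.comp (tendsto_nhdsWithin_iff.2 ⟨?_, ?_⟩)
    · have h2 := (by fun_prop : Continuous fun t : ℝ => (t : ℂ) * d).tendsto 0
      simp only [Complex.ofReal_zero, zero_mul] at h2
      exact h2.mono_left nhdsWithin_le_nhds
    · filter_upwards [Ioo_mem_nhdsGT ht₀] with t ht
      exact hsmall t ht.1 ht.2
  set γ : ℝ → X := fun t => if t ≤ 0 then x₀ else if t < T then Φ (t * d) else q with hγ
  have hγmid : ∀ t : ℝ, 0 < t → t < T → γ t = Φ (t * d) := fun t ht htT => by
    simp only [hγ, not_le.2 ht, htT, if_true, if_false]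
  have hγ0 : γ 0 = x₀ := by simp [hγ]
  have hγT : γ T = q := by simp [hγ, not_le.2 hT]
  have hγφ : ∀ᶠ t : ℝ in 𝓝[>] 0, γ t = φ ((t : ℂ) * d) := by
    filter_upwards [Ioo_mem_nhdsGT (lt_min ht₀ hT)] with t ht
    rw [hγmid t ht.1 (ht.2.trans_le (min_le_right _ _)), hΦ,
      h.extension_eq (hsmall t ht.1 (ht.2.trans_le (min_le_left _ _)))]
  have hγev : ∀ t : ℝ, 0 < t → t < T → ∀ᶠ s in 𝓝 t, γ s = Φ (s * d) := fun t ht htT => by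
    filter_upwards [Ioo_mem_nhds ht htT] with s hs
    exact hγmid s hs.1 hs.2
  have hline : ∀ t : ℝ, Tendsto (fun s : ℝ => (s : ℂ) * d) (𝓝 t) (𝓝 (t * d)) := fun t =>
    (by fun_prop : Continuous fun s : ℝ => (s : ℂ) * d).tendsto t
  refine ⟨d, hdK, T, γ, hT, ?_, hγ0, hγφ, ?_, hγT⟩
  · intro t ht
    rcases ht.1.eq_or_lt with rfl | ht0
    · refine ContinuousWithinAt.mono ?_ Icc_subset_Ici_self
      rw [← continuousWithinAt_Ioi_iff_Ici, ContinuousWithinAt, hγ0]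
      exact hφ0.congr' (hγφ.mono fun s hs => hs.symm)
    rcases ht.2.eq_or_lt with rfl | htT
    · refine ContinuousWithinAt.mono ?_ Icc_subset_Iic_self
      rw [← continuousWithinAt_Iio_iff_Iic, ContinuousWithinAt, hγT]
      have h1 : Tendsto (fun s : ℝ => s / t) (𝓝[<] t) (𝓝[<] 1) := by
        refine tendsto_nhdsWithin_iff.2 ⟨?_, ?_⟩
        · have h2 := (by fun_prop : Continuous fun s : ℝ => s / t).tendsto t
          rw [div_self hT.ne'] at h2
          exact h2.mono_left nhdsWithin_le_nhds
        · filter_upwards [self_mem_nhdsWithin] with s hs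
          exact (div_lt_one hT).2 hs
      refine (hq.comp h1).congr' ?_
      filter_upwards [Ioo_mem_nhdsLT hT] with s hs
      rw [hγmid s hs.1 hs.2, hdz, Function.comp_apply]
    · refine ContinuousAt.continuousWithinAt ?_
      have h1 : ContinuousAt (fun s : ℝ => Φ (s * d)) t :=
        ContinuousAt.comp (f := fun s : ℝ => (s : ℂ) * d)
          (h.immersed_extension (hdD t ht0 htT)).continuousAt (hline t)
      exact h1.congr ((hγev t ht0 htT).mono fun s hs => hs.symm)
  · intro t ht
    obtain ⟨e, he, a, ha, hs, hev⟩ := h.immersed_extension (hdD t ht.1 ht.2)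
    refine ⟨e, he, by rwa [hγmid t ht.1 ht.2], a, ha, ?_⟩
    filter_upwards [((hline t).eventually hev).filter_mono nhdsWithin_le_nhds,
      (hγev t ht.1 ht.2).filter_mono nhdsWithin_le_nhds] with s h1 h2
    rw [h2, hγmid t ht.1 ht.2]
    refine ⟨h1.1, ?_⟩
    rw [h1.2]
    push_cast
    ring

/-- The extension of a pencil along a trajectory does not end inside a chart. -/
theorem IsConePencil.notMem_ball (h : S.IsConePencil x₀ φ u δ ε)
    (hit : ∀ d : Circle, (d : ℂ) ∈ openCone u δ → ∀ y, S.TrajectoryReaches x₀ φ d y →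
      y ∉ S.sing ∧ y ∉ S.boundary)
    (hz : z ∈ openCone u δ) (hzD : z ∉ S.domain φ u δ ε) {G : Set ℂ} (hGD : G ⊆ S.domain φ u δ ε)
    (hGo : IsOpen G) (hG : Convex ℝ G) (hGz : ∀ t : ℝ, 0 < t → t < 1 → (t : ℂ) * z ∈ G)
    {e : PartialEquiv X ℂ} (he : e ∈ S.charts) {v : ℂ} {r : ℝ}
    (hr : ∀ w ∈ Metric.ball v r, w ∈ closure e.target → w ∈ e.target) {t a : ℝ} (ht0 : 0 < t)
    (ht1 : t < 1) (ha : DilationAtlas.HasScaleAt (S.extension φ u δ ε) (t * z) e a)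
    (hv : e (S.extension φ u δ ε (t * z)) ∈ Metric.ball v r) :
    e (S.extension φ u δ ε (t * z)) + a * (z - t * z) ∉ Metric.ball v r := by
  intro hball
  set Φ := S.extension φ u δ ε with hΦ
  have hΦG : ∀ w ∈ G, S.ImmersedAt Φ w := fun w hw => h.immersed_extension (hGD hw)
  set A : ℂ → ℂ := fun w => e (Φ (t * z)) + a * (w - t * z) with hA
  have hAc : Continuous A := by fun_prop
  have hcont : ∀ w ∈ G, A w ∈ Metric.ball v r → DilationAtlas.HasScaleAt Φ w e a ∧ e (Φ w) = A w :=
    fun w hw hwb => ha.continuation hG hΦG he (hGz t ht0 ht1) hr hv hw hwb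
  have hlim : Tendsto (fun s : ℝ => (s : ℂ) * z) (𝓝[<] 1) (𝓝 z) := by
    have h2 := (by fun_prop : Continuous fun t : ℝ => (t : ℂ) * z).tendsto 1
    simp only [Complex.ofReal_one, one_mul] at h2
    exact h2.mono_left nhdsWithin_le_nhds
  have hAlim : Tendsto (fun s : ℝ => A (s * z)) (𝓝[<] 1) (𝓝 (A z)) := (hAc.tendsto z).comp hlim
  have hev : ∀ᶠ s : ℝ in 𝓝[<] 1, Φ (s * z) ∈ e.source ∧ e (Φ (s * z)) = A (s * z) := by
    filter_upwards [hAlim (Metric.isOpen_ball.mem_nhds hball), Ioo_mem_nhdsLT one_pos] with s hs hs1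
    have := hcont _ (hGz s hs1.1 hs1.2) hs
    exact ⟨this.1.2.1, this.2⟩
  have htgt : ∀ᶠ s : ℝ in 𝓝[<] 1, A (s * z) ∈ e.target := hev.mono fun s hs =>
    hs.2 ▸ e.map_source hs.1
  have hAz : A z ∈ e.target := hr _ hball (mem_closure_of_tendsto hAlim htgt)
  have hq : Tendsto (fun s : ℝ => Φ (s * z)) (𝓝[<] 1) (𝓝 (e.symm (A z))) := by
    refine Tendsto.congr' ?_ ((S.continuousOn_symm e he _ hAz).tendsto.comp
      (tendsto_nhdsWithin_iff.2 ⟨hAlim, htgt⟩))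
    filter_upwards [hev] with s hs
    rw [Function.comp_apply, ← hs.2, e.left_inv hs.1]
  -- The continued chart expression gives the trajectory an endpoint in the chart. Since this
  -- endpoint is not on the boundary, the chart covers a full disc around `A z`.
  obtain ⟨d, hd, hreach⟩ := h.trajectoryReaches hz (fun s h0 h1 => hGD (hGz s h0 h1)) hq
  have hnhds : e.target ∈ 𝓝 (A z) := by
    by_contra hcon
    refine (hit d hd _ hreach).2 (Or.inl ⟨e, he, e.map_target hAz, ?_⟩)
    rwa [e.right_inv hAz]
  obtain ⟨η, hη, hηsub⟩ := Metric.mem_nhds_iff.1 (hAc.continuousAt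
    (inter_mem (interior_mem_nhds.2 hnhds) (Metric.isOpen_ball.mem_nhds hball)))
  classical
  -- The chart is used to continue `Φ` past `z`. A thickening of a segment ending at `z` is convex
  -- and lies in `G ∪ ball z η`, so this contradicts `z ∉ domain`.
  set Ψ : ℂ → X := fun w => if w ∈ Metric.ball z η then e.symm (A w) else Φ w with hΨ
  have hΨball : ∀ w ∈ Metric.ball z η, Ψ w = e.symm (A w) := fun w hw => if_pos hw
  have hΨG : ∀ w ∈ G, Ψ w = Φ w := fun w hw => by
    by_cases hwb : w ∈ Metric.ball z η
    · have h1 := hcont w hw (hηsub hwb).2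
      rw [hΨball w hwb, ← h1.2, e.left_inv h1.1.2.1]
    · exact if_neg hwb
  have hΨim : ∀ w ∈ G ∪ Metric.ball z η, S.ImmersedAt Ψ w := by
    rintro w (hw | hw)
    · exact (hΦG w hw).congr ((hGo.eventually_mem hw).mono hΨG)
    · refine DilationAtlas.ImmersedAt.congr (Φ := fun w => e.symm
        ((e (Φ (t * z)) - a * (t * z)) + a * w)) ⟨e, he, a, ?_⟩ ?_
      · refine DilationAtlas.hasScaleAt_symm ha.1 ?_
        have h1 := mem_interior_iff_mem_nhds.1 (hηsub hw).1
        convert h1 using 2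
        simp only [hA]
        ring
      · filter_upwards [Metric.isOpen_ball.mem_nhds hw] with w' hw'
        rw [hΨball w' hw']
        simp only [hA]
        congr 1
        ring
  obtain ⟨t₀, ht₀, hsmall⟩ := exists_smul_mem_coneSector h.ε_pos hz
  obtain ⟨m, hm0, hm⟩ := exists_between (lt_min ht₀ one_pos)
  have hmP := hsmall m hm0 (hm.trans_le (min_le_left _ _))
  have hm1 : m < 1 := hm.trans_le (min_le_right _ _)
  have hseg : segment ℝ ((m : ℂ) * z) z ⊆ G ∪ Metric.ball z η := by
    rintro _ ⟨b, c, hb, hc, hbc, rfl⟩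
    have h1 : b • ((m : ℂ) * z) + c • z = ((b * m + c : ℝ) : ℂ) * z := by
      simp only [Complex.real_smul]
      push_cast
      ring
    rw [h1]
    rcases hb.eq_or_lt with rfl | hb
    · right
      rw [zero_add] at hbc
      simp [hbc, hη]
    · left
      exact hGz _ (by positivity) (by nlinarith)
  have hsegc : IsCompact (segment ℝ ((m : ℂ) * z) z) := by
    rw [segment_eq_image_lineMap]
    exact isCompact_Icc.image (by fun_prop)
  obtain ⟨η', hη', hthick⟩ := hsegc.exists_thickening_subset_open (hGo.union Metric.isOpen_ball) hseg
  have hself := Metric.self_subset_thickening hη' (segment ℝ ((m : ℂ) * z) z)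
  refine hzD ⟨_, Ψ, Metric.isOpen_thickening, (convex_segment _ _).thickening η',
    hself (right_mem_segment ℝ _ _), fun w hw => hΨim w (hthick hw), m, hm0, hm1.le,
    hself (left_mem_segment ℝ _ _), hmP, ?_⟩
  filter_upwards [hGo.mem_nhds (hGz m hm0 hm1), (isOpen_coneSector u δ ε).mem_nhds hmP] with w h1 h2
  rw [hΨG w h1, hΦ, h.extension_eq h2]

/-- If a pencil does not extend to the whole cone, then there is a hyperbolic closed geodesic. -/
theorem IsConePencil.exists_hyperbolic_of_notMem [CompactSpace X] (h : S.IsConePencil x₀ φ u δ ε)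
    (hit : ∀ d : Circle, (d : ℂ) ∈ openCone u δ → ∀ y, S.TrajectoryReaches x₀ φ d y →
      y ∉ S.sing ∧ y ∉ S.boundary)
    {z₁ : ℂ} (hz₁ : z₁ ∈ openCone u δ) (hz₁D : z₁ ∉ S.domain φ u δ ε) :
    ∃ (γ : ℝ → X) (d : Circle) (r : ℝ), 0 < r ∧ (r : ℂ) * d ∈ openCone u δ ∧
      S.IsHyperbolicClosedGeodesic γ d := by
  obtain ⟨z, hz, hzD, G, hGD, hGo, hG, hGz, -⟩ := exists_touching_point h.ε_pos
    (DilationAtlas.isOpen_developDomain (isOpen_coneSector u δ ε))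
    (DilationAtlas.subset_developDomain (isOpen_coneSector u δ ε) (convex_coneSector u δ ε)
      h.immersed) hz₁ hz₁D
  set Φ := S.extension φ u δ ε with hΦ
  have hΦG : ∀ w ∈ G, S.ImmersedAt Φ w := fun w hw => h.immersed_extension (hGD hw)
  have hzn : 0 < ‖z‖ := norm_pos_iff.2 (ne_zero_of_mem_openCone hz)
  have hpath : ContinuousOn (fun t : ℝ => Φ (t * z)) (Ioo 0 1) := fun t ht =>
    (ContinuousAt.comp (f := fun s : ℝ => (s : ℂ) * z) (hΦG _ (hGz t ht.1 ht.2)).continuousAt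
      (by fun_prop)).continuousWithinAt
  obtain ⟨y, hys, hy⟩ : ∃ y, y ∉ S.sing ∧ ClusterPt y (map (fun t : ℝ => Φ (t * z)) (𝓝[<] 1)) := by
    by_contra hcon
    push Not at hcon
    have hcl : ∀ y, ClusterPt y (map (fun t : ℝ => Φ (t * z)) (𝓝[<] 1)) → y ∈ S.sing := fun y hy => by
      by_contra hys
      exact hcon y hys hy
    obtain ⟨M, hM, hdisj, hev⟩ := exists_isOpen_nhd_of_clusterPt_mem S.finite_sing hcl
      (N := fun _ => univ) fun _ _ => univ_mem
    obtain ⟨t₀, ht₀, hsub⟩ := (mem_nhdsLT_iff_exists_mem_Ico_Ioo_subset one_pos).1 hev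
    obtain ⟨x, hx, hmaps⟩ := exists_mapsTo_of_mapsTo_biUnion (fun x hx => (hM x hx).1) hdisj
      (V := Ioo t₀ 1) isPreconnected_Ioo (nonempty_Ioo.2 ht₀.2)
      (hpath.mono (Ioo_subset_Ioo_left ht₀.1)) hsub
    -- By connectedness the end of the curve stays near one singularity, which is then its only
    -- cluster point. The trajectory would thus reach a singularity.
    have hlim : Tendsto (fun t : ℝ => Φ (t * z)) (𝓝[<] 1) (𝓝 x) := by
      refine le_nhds_of_unique_clusterPt fun y hy => ?_
      by_contra hyx
      have hyS := hcl y hy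
      have h1 : M x ∈ map (fun t : ℝ => Φ (t * z)) (𝓝[<] 1) :=
        
        mem_map.2 (mem_of_superset (Ioo_mem_nhdsLT ht₀.2) fun t ht => hmaps ht)
      obtain ⟨p, hp1, hp2⟩ := clusterPt_iff_nonempty.1 hy
        ((hM y hyS).1.mem_nhds (hM y hyS).2.1) h1
      exact (disjoint_left.1 (hdisj hyS hx hyx)) hp1 hp2
    obtain ⟨d, hd, hreach⟩ := h.trajectoryReaches hz (fun t h0 h1 => hGD (hGz t h0 h1)) hlim
    exact (hit d hd x hreach).1 hx
  obtain ⟨e, he, hye⟩ := S.cover y hys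
  obtain ⟨r, hr, hrad⟩ := (S.flat_target e he).exists_radius (e.map_source hye)
  obtain ⟨κ, hκ, hκG⟩ := hG.exists_ball_smul_subset hGo hGz
  have step : ∀ η : ℝ, 0 < η → ∃ (t a : ℝ) (w : ℂ), 1 - η < t ∧ t < 1 ∧ w ∈ G ∧ Φ w = y ∧
      DilationAtlas.HasScaleAt Φ w e a ∧ 1 / η < a ∧ ‖w - t * z‖ ≤ η * (1 - t) := by
    intro η hη
    -- The bound `ε' ≤ r / 2` leaves at least `r / 2` to cross before leaving the chart disc, so `a
    -- (1 - t) ‖z‖ ≥ r / 2`. The second bound then makes `ε' / a ≤ min (κ / 2) η (1 - t)`: the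
    -- preimage of `y` stays in `G` and is close to `t z`.
    obtain ⟨ε', hε', hε'1⟩ : ∃ ε' : ℝ, 0 < ε' ∧ ε' ≤ r / 2 ∧ ε' * (2 * ‖z‖ / r) ≤ min (κ / 2) η := by
      refine ⟨min (r / 2) (min (κ / 2) η / (2 * ‖z‖ / r)), by positivity, min_le_left _ _, ?_⟩
      rw [← le_div_iff₀ (by positivity)]
      exact min_le_right _ _
    obtain ⟨hε'r, hε'η⟩ := hε'1
    have hnb : e.source ∩ e ⁻¹' Metric.ball (e y) ε' ∈ 𝓝 y := by
      have h1 := (S.isOpen_source e he).mem_nhds hye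
      exact inter_mem h1 (((S.continuousOn_chart e he).continuousAt h1)
        (Metric.ball_mem_nhds _ hε'))
    have hlow : max (1 / 2) (1 - min η (η * r / (2 * ‖z‖))) < 1 := by
      refine max_lt (by norm_num) ?_
      have : 0 < min η (η * r / (2 * ‖z‖)) := by positivity
      linarith
    obtain ⟨t, ⟨hts, htb⟩, ht⟩ := ((mapClusterPt_iff_frequently.1 hy _ hnb).and_eventually
      (Ioo_mem_nhdsLT hlow)).exists
    obtain ⟨ht', ht1⟩ := ht
    have ht2 : 1 / 2 < t := (le_max_left _ _).trans_lt ht'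
    have ht3 : 1 - min η (η * r / (2 * ‖z‖)) < t := (le_max_right _ _).trans_lt ht'
    have ht4 : 1 - t < η := by linarith [min_le_left η (η * r / (2 * ‖z‖))]
    have ht5 : 1 - t < η * r / (2 * ‖z‖) := by linarith [min_le_right η (η * r / (2 * ‖z‖))]
    have h1t : 0 < 1 - t := by linarith
    have htG := hGz t (by linarith) ht1
    obtain ⟨a, ha⟩ := (hΦG _ htG).exists_hasScaleAt he hts
    have ha0 := ha.1
    have haC : (a : ℂ) ≠ 0 := by exact_mod_cast ha0.ne'
    replace htb : ‖e (Φ (t * z)) - e y‖ < ε' := by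
      rw [← dist_eq_norm]
      exact htb
    have hvr : e (Φ (t * z)) ∈ Metric.ball (e y) r := by
      rw [Metric.mem_ball, dist_eq_norm]
      linarith
    have hend := h.notMem_ball hit hz hzD hGD hGo hG hGz he hrad (by linarith) ht1 ha hvr
    rw [Metric.mem_ball, dist_eq_norm, not_lt] at hend
    have hbig : r / 2 ≤ a * ((1 - t) * ‖z‖) := by
      have h1 : e (Φ (t * z)) + a * (z - t * z) - e y =
          (e (Φ (t * z)) - e y) + (a : ℂ) * (((1 - t : ℝ) : ℂ) * z) := by
        push_cast
        ring
      rw [← hΦ, h1] at hend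
      have h2 := hend.trans (norm_add_le _ _)
      rw [norm_mul, norm_mul, Complex.norm_real, Complex.norm_real, Real.norm_of_nonneg ha0.le,
        Real.norm_of_nonneg h1t.le] at h2
      linarith
    have hwn : ‖(t * z + (e y - e (Φ (t * z))) / a : ℂ) - t * z‖ ≤ min (κ / 2) η * (1 - t) := by
      rw [add_sub_cancel_left, norm_div, Complex.norm_real, Real.norm_of_nonneg ha0.le, norm_sub_rev,
        div_le_iff₀ ha0]
      calc ‖e (Φ (t * z)) - e y‖ ≤ ε' := htb.le
        _ = ε' * (2 / r) * (r / 2) := by field_simp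
        _ ≤ ε' * (2 / r) * (a * ((1 - t) * ‖z‖)) := by gcongr
        _ = ε' * (2 * ‖z‖ / r) * (1 - t) * a := by ring
        _ ≤ min (κ / 2) η * (1 - t) * a := by gcongr
    have hwG : (t * z + (e y - e (Φ (t * z))) / a : ℂ) ∈ G := by
      refine hκG t ht2.le ht1 ?_
      rw [Metric.mem_ball, dist_eq_norm]
      refine hwn.trans_lt ?_
      have : min (κ / 2) η < κ := (min_le_left _ _).trans_lt (by linarith)
      gcongr
    have hAw : e (Φ (t * z)) + a * ((t * z + (e y - e (Φ (t * z))) / a) - t * z) = e y := by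
      field_simp
      ring
    obtain ⟨h1, h2⟩ := ha.continuation hG hΦG he htG hrad hvr hwG
      (by rw [hAw]; exact Metric.mem_ball_self hr)
    refine ⟨t, a, _, by linarith, ht1, hwG, e.injOn h1.2.1 hye (h2.trans hAw), h1, ?_,
      hwn.trans (by gcongr; exact min_le_right _ _)⟩
    rw [div_lt_iff₀ hη]
    rw [lt_div_iff₀ (by positivity)] at ht5
    by_contra hcon
    push Not at hcon
    have h3 : a * ((1 - t) * ‖z‖) * η ≤ (1 - t) * ‖z‖ := by nlinarith [mul_pos h1t hzn]
    have h4 : r / 2 * η ≤ a * ((1 - t) * ‖z‖) * η := by gcongr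
    linarith
  obtain ⟨η₁, hη₁, hball₁⟩ := Metric.isOpen_iff.1 (isOpen_openCone u δ) z hz
  obtain ⟨t₁, a₁, w₁, -, ht₁, hw₁G, hw₁y, hw₁, -, hw₁n⟩ := step (η₁ / 2) (by positivity)
  have h1t : 0 < 1 - t₁ := by linarith
  -- After division by `1 - t₁`, the vector `z - w₁` is a small perturbation of `z`.
  have hzw : z - w₁ ∈ openCone u δ := by
    have h1tC : (1 : ℂ) - t₁ ≠ 0 := by exact_mod_cast h1t.ne'
    have h1 : z - (w₁ - t₁ * z) / ((1 - t₁ : ℝ) : ℂ) ∈ openCone u δ := by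
      refine hball₁ ?_
      rw [Metric.mem_ball, dist_eq_norm, sub_sub_cancel_left, norm_neg, norm_div, Complex.norm_real,
        Real.norm_of_nonneg h1t.le, div_lt_iff₀ h1t]
      nlinarith
    have h2 := smul_mem_openCone h1t h1
    convert h2 using 1
    push_cast
    field_simp
    ring
  obtain ⟨η₂, hη₂, hball₂⟩ := Metric.isOpen_iff.1 (isOpen_openCone u δ) _ hzw
  -- The bound `1 / a₁` forces `a₂ > a₁`. The bound `η₂ / (1 + ‖z‖)` brings `w₂` so close to `z`
  -- that `w₂ - w₁` is still in the cone.
  have hη₃ : 0 < min (min 1 (1 / a₁)) (η₂ / (1 + ‖z‖)) := by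
    have := hw₁.1
    positivity
  obtain ⟨t₂, a₂, w₂, ht₂', ht₂, hw₂G, hw₂y, hw₂, ha₂, hw₂n⟩ := step _ hη₃
  set η₃ := min (min 1 (1 / a₁)) (η₂ / (1 + ‖z‖)) with hη₃def
  have hle1 : η₃ ≤ 1 := (min_le_left _ _).trans (min_le_left _ _)
  have hle2 : η₃ ≤ 1 / a₁ := (min_le_left _ _).trans (min_le_right _ _)
  have hle3 : η₃ ≤ η₂ / (1 + ‖z‖) := min_le_right _ _
  have hdir : w₂ - w₁ ∈ openCone u δ := by
    refine hball₂ ?_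
    have h1 : w₂ - w₁ - (z - w₁) = (w₂ - t₂ * z) - ((1 - t₂ : ℝ) : ℂ) * z := by
      push_cast
      ring
    rw [Metric.mem_ball, dist_eq_norm, h1]
    refine (norm_sub_le _ _).trans_lt ?_
    rw [norm_mul, Complex.norm_real, Real.norm_of_nonneg (by linarith)]
    rw [le_div_iff₀ (by positivity)] at hle3
    calc ‖w₂ - t₂ * z‖ + (1 - t₂) * ‖z‖ ≤ η₃ * (1 - t₂) + (1 - t₂) * ‖z‖ := by gcongr
      _ ≤ 1 * (1 - t₂) + (1 - t₂) * ‖z‖ := by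
        have : 0 ≤ 1 - t₂ := by linarith
        gcongr
      _ = (1 - t₂) * (1 + ‖z‖) := by ring
      _ < η₃ * (1 + ‖z‖) := by
        have : 1 - t₂ < η₃ := by linarith
        gcongr
      _ ≤ η₂ := hle3
  obtain ⟨ρ, d, hρ, hρd⟩ := exists_eq_real_mul_circle (ne_zero_of_mem_openCone hdir)
  refine ⟨_, d, ρ, hρ, hρd ▸ hdir, DilationAtlas.isHyperbolicClosedGeodesic_segment hG hΦG he hw₁G
    hw₂G (hw₁y.trans hw₂y.symm) hw₁ hw₂ ?_ hρ hρd⟩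
  rintro rfl
  have h1 := hw₁.1
  have h2 : a₁ ≤ 1 / η₃ := by
    rw [le_div_iff₀ hη₃, mul_comm, ← le_div_iff₀ h1]
    exact hle2
  linarith

end DilationSurface

/-! ### Immersions of an infinite cone. -/

theorem abs_re_mul_conj_le (u : Circle) (z : ℂ) : |(z * (starRingEnd ℂ) (u : ℂ)).re| ≤ ‖z‖ := by
  refine (Complex.abs_re_le_norm _).trans ?_
  rw [norm_mul, Complex.norm_conj, Circle.norm_coe, mul_one]

theorem abs_im_mul_conj_le (u : Circle) (z : ℂ) : |(z * (starRingEnd ℂ) (u : ℂ)).im| ≤ ‖z‖ := by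
  refine (Complex.abs_im_le_norm _).trans ?_
  rw [norm_mul, Complex.norm_conj, Circle.norm_coe, mul_one]

/-- A slight perturbation of a point of a cone stays in a slightly larger cone. -/
theorem mem_openCone_of_norm_sub_le {u : Circle} {δ δ' C : ℝ} (hδ' : 0 ≤ δ') {z w : ℂ}
    (hz : z ∈ openCone u δ) (h : ‖w - z‖ ≤ C)
    (hC : (1 + δ') * C ≤ (δ' - δ) * (z * (starRingEnd ℂ) (u : ℂ)).re) : w ∈ openCone u δ' := by
  rw [mem_openCone] at hz ⊢
  have h1 := (abs_re_mul_conj_le u (w - z)).trans h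
  have h2 := (abs_im_mul_conj_le u (w - z)).trans h
  rw [sub_mul, Complex.sub_re] at h1
  rw [sub_mul, Complex.sub_im] at h2
  have h3 := abs_sub_abs_le_abs_sub (w * (starRingEnd ℂ) (u : ℂ)).im
    (z * (starRingEnd ℂ) (u : ℂ)).im
  have h4 := (abs_le.1 h1).1
  nlinarith

namespace DilationSurface

variable {X : Type*} [TopologicalSpace X] [T2Space X] {S : DilationSurface X} {Φ : ℂ → X}
  {u : Circle} {δ : ℝ} {y : X} {e : PartialEquiv X ℂ}

/-- An immersion of an infinite cone accumulates at infinity at a regular point. -/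
theorem exists_regular_clusterPt [CompactSpace X] (hδ : 0 < δ)
    (hΦ : ∀ z ∈ openCone u δ, S.ImmersedAt Φ z) :
    ∃ y ∉ S.sing, ∀ N ∈ 𝓝 y, ∀ R : ℝ, ∃ z ∈ openCone u δ,
      R < (z * (starRingEnd ℂ) (u : ℂ)).re ∧ Φ z ∈ N := by
  set ξ : ℂ → ℝ := fun z => (z * (starRingEnd ℂ) (u : ℂ)).re with hξ
  -- This is the filter of points going to infinity in the cone. Its basic sets are convex and
  -- contain, from every point `p` of the plane, the far part of a ray in direction `u`, as required
  -- to exclude conical neighbourhoods.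
  set F : Filter ℂ := comap ξ atTop ⊓ 𝓟 (openCone u δ) with hF
  have hbasis := (atTop_basis_Ioi.comap ξ).inf_principal (openCone u δ)
  rw [← hF] at hbasis
  have hray : ∀ (R : ℝ) (p : ℂ), ∃ v : ℂ, ∀ l : ℝ, 1 ≤ l → p + l * v ∈ ξ ⁻¹' Ioi R ∩ openCone u δ := by
    intro R p
    set m := |ξ p| + |R| + |(p * (starRingEnd ℂ) (u : ℂ)).im| / δ + 1 with hm
    have hm0 : 0 < m := by positivity
    refine ⟨m * u, fun l hl => ?_⟩
    have h1 : (p + l * (m * u)) * (starRingEnd ℂ) (u : ℂ) =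
        p * (starRingEnd ℂ) (u : ℂ) + ((l * m : ℝ) : ℂ) := by
      have := circle_mul_conj u
      push_cast
      linear_combination (l : ℂ) * m * this
    have h2 : (p * (starRingEnd ℂ) (u : ℂ)).re = ξ p := rfl
    have h3 : m ≤ l * m := by nlinarith
    have h4 := neg_abs_le (ξ p)
    have h5 := le_abs_self R
    have h6 : 0 ≤ |(p * (starRingEnd ℂ) (u : ℂ)).im| / δ := by positivity
    constructor
    · show R < ((p + l * (m * u)) * (starRingEnd ℂ) (u : ℂ)).re
      rw [h1, Complex.add_re, Complex.ofReal_re, h2]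
      linarith
    · rw [mem_openCone, h1, Complex.add_re, Complex.ofReal_re, Complex.add_im, Complex.ofReal_im,
        add_zero, h2, ← div_lt_iff₀' hδ]
      have := abs_nonneg R
      linarith
  have hFne : F.NeBot := by
    refine hbasis.neBot_iff.2 fun {R} _ => ?_
    obtain ⟨v, hv⟩ := hray R 0
    exact ⟨_, hv 1 le_rfl⟩
  have hξc : Continuous ξ := by fun_prop
  have hVo : ∀ R, IsOpen (ξ ⁻¹' Ioi R ∩ openCone u δ) := fun R =>
    (isOpen_Ioi.preimage hξc).inter (isOpen_openCone u δ)
  have hVc : ∀ R, Convex ℝ (ξ ⁻¹' Ioi R ∩ openCone u δ) := fun R => by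
    refine Convex.inter ?_ (convex_openCone u δ)
    refine (convex_Ioi R).is_linear_preimage ⟨fun z w => ?_, fun t z => ?_⟩
    · simp only [hξ, add_mul, Complex.add_re]
    · simp only [hξ, Complex.real_smul, mul_assoc, Complex.re_ofReal_mul, smul_eq_mul]
  by_contra hcon
  have hcl : ∀ y, ClusterPt y (map Φ F) → y ∈ S.sing := by
    intro y hy
    by_contra hys
    refine hcon ⟨y, hys, fun N hN R => ?_⟩
    obtain ⟨z, hz1, hz2⟩ := ((mapClusterPt_iff_frequently.1 hy N hN).and_eventually
      (hbasis.mem_of_mem (i := R) trivial)).exists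
    exact ⟨z, hz2.2, hz2.1, hz1⟩
  have hN : ∀ x, ∃ N, x ∈ S.sing → IsOpen N ∧ x ∈ N ∧
      (∀ (Φ : ℂ → X) (V : Set ℂ), IsOpen V → IsPreconnected V →
        (∀ p : ℂ, ∃ v : ℂ, ∀ l : ℝ, 1 ≤ l → p + l * v ∈ V) →
        (∀ w ∈ V, S.ImmersedAt Φ w) → ¬ MapsTo Φ V N) := by
    intro x
    by_cases hx : x ∈ S.sing
    · obtain ⟨N, h1, h2, h3, -⟩ := exists_cone_nhd hx
      exact ⟨N, fun _ => ⟨h1, h2, h3⟩⟩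
    · exact ⟨∅, fun h => absurd h hx⟩
  choose N hN using hN
  obtain ⟨M, hM, hdisj, hev⟩ := exists_isOpen_nhd_of_clusterPt_mem S.finite_sing hcl (N := N)
    fun x hx => (hN x hx).1.mem_nhds (hN x hx).2.1
  obtain ⟨R, -, hR⟩ := hbasis.mem_iff.1 hev
  obtain ⟨v, hv⟩ := hray R 0
  obtain ⟨x, hx, hmaps⟩ := exists_mapsTo_of_mapsTo_biUnion (f := Φ) (fun x hx => (hM x hx).1) hdisj
    (hVc R).isPreconnected ⟨_, hv 1 le_rfl⟩
    (fun z hz => (hΦ z hz.2).continuousAt.continuousWithinAt) hR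
  exact (hN x hx).2.2 Φ _ (hVo R) (hVc R).isPreconnected (hray R) (fun w hw => hΦ w hw.2)
    (hmaps.mono_right (hM x hx).2.2)

/-- An immersion of an infinite cone takes some regular value at points tending to infinity. -/
theorem exists_preimages_at_infinity [CompactSpace X] (hδ : 0 < δ)
    (hΦ : ∀ z ∈ openCone u δ, S.ImmersedAt Φ z) :
    ∃ y, ∃ e ∈ S.charts, y ∈ e.source ∧ ∀ R : ℝ, ∃ w ∈ openCone u (3 / 4 * δ),
      R < (w * (starRingEnd ℂ) (u : ℂ)).re ∧ Φ w = y ∧ ∃ a, DilationAtlas.HasScaleAt Φ w e a := by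
  -- Nested cones: accumulation is obtained in the cone of opening `δ / 2`, the exact preimages in
  -- that of opening `3 / 4 * δ`, and `Φ` is immersed in that of opening `δ`.
  have hsub : openCone u (δ / 2) ⊆ openCone u δ := openCone_mono (by positivity) (by linarith)
  obtain ⟨y, hys, hy⟩ := exists_regular_clusterPt (S := S) (half_pos hδ) fun z hz => hΦ z (hsub hz)
  obtain ⟨e, he, hye⟩ := S.cover y hys
  obtain ⟨r, hr, hrad⟩ := (S.flat_target e he).exists_radius (e.map_source hye)
  refine ⟨y, e, he, hye, fun R => ?_⟩
  have huK : (u : ℂ) ∈ openCone u δ := by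
    simpa using real_mul_circle_mem_openCone (u := u) hδ one_pos
  -- The scale of `Φ` at the fixed point `u` in the chart `e`, if there is one, is unique. `R₁`
  -- turns this into a lower bound.
  obtain ⟨R₁, hR₁⟩ : ∃ R₁ : ℝ, ∀ a, DilationAtlas.HasScaleAt Φ u e a → r / 4 ≤ a * R₁ := by
    by_cases h : ∃ a, DilationAtlas.HasScaleAt Φ u e a
    · obtain ⟨a, ha⟩ := h
      refine ⟨r / 4 / a, fun a' ha' => ?_⟩
      rw [← ha.unique ha', mul_div_cancel₀ _ ha.1.ne']
    · exact ⟨0, fun a ha => absurd ⟨a, ha⟩ h⟩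
  set η := min (1 / 2) (δ / (8 * (1 + δ))) with hη
  have hη0 : 0 < η := by positivity
  have hη1 : η ≤ 1 / 2 := min_le_left _ _
  have hη2 : η * (8 * (1 + δ)) ≤ δ := by
    rw [← le_div_iff₀ (by positivity)]
    exact min_le_right _ _
  set ε' := min (r / 4) (η * (r / 4) / (1 + δ / 2)) with hε'
  have hε'0 : 0 < ε' := by positivity
  have hε'1 : ε' ≤ r / 4 := min_le_left _ _
  have hε'2 : ε' * (1 + δ / 2) ≤ η * (r / 4) := by
    rw [← le_div_iff₀ (by positivity)]
    exact min_le_right _ _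
  have hnb : e.source ∩ e ⁻¹' Metric.ball (e y) ε' ∈ 𝓝 y := by
    have h1 := (S.isOpen_source e he).mem_nhds hye
    exact inter_mem h1 (((S.continuousOn_chart e he).continuousAt h1)
      (Metric.ball_mem_nhds _ hε'0))
  obtain ⟨z, hz, hzR, hzs, hzb⟩ := hy _ hnb (max 1 (max R₁ (2 * |R|)))
  obtain ⟨hz1, hzR'⟩ := max_lt_iff.1 hzR
  obtain ⟨hzR₁, hzR₂⟩ := max_lt_iff.1 hzR'
  set x := (z * (starRingEnd ℂ) (u : ℂ)).re with hx
  have hxn : x ≤ ‖z‖ := (le_abs_self _).trans (abs_re_mul_conj_le u z)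
  have hnx : ‖z‖ ≤ (1 + δ / 2) * x := by
    have h1 := norm_le_re_add_im (u := u) (z := z)
    have h2 := mem_openCone.1 hz
    rw [← hx, abs_of_pos (by linarith : 0 < x)] at h1
    rw [← hx] at h2
    linarith
  have hzK := hsub hz
  obtain ⟨a, ha⟩ := (hΦ z hzK).exists_hasScaleAt he hzs
  have ha0 := ha.1
  have haC : (a : ℂ) ≠ 0 := by exact_mod_cast ha0.ne'
  replace hzb : ‖e (Φ z) - e y‖ < ε' := by
    rw [← dist_eq_norm]
    exact hzb
  have hvr : e (Φ z) ∈ Metric.ball (e y) r := by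
    rw [Metric.mem_ball, dist_eq_norm]
    linarith
  -- If the scale at `z` were smaller, the chart expression would continue back to `u` with the same
  -- scale `a`. Then `r / 4 ≤ a R₁ ≤ a ‖z‖` after all.
  have haz : r / 4 ≤ a * ‖z‖ := by
    by_contra hcon
    push Not at hcon
    have h1 : e (Φ z) + a * (u - z) ∈ Metric.ball (e y) r := by
      have h2 : e (Φ z) + a * (u - z) - e y = (e (Φ z) - e y) + (a : ℂ) * (u - z) := by ring
      rw [Metric.mem_ball, dist_eq_norm, h2]
      refine (norm_add_le _ _).trans_lt ?_
      rw [norm_mul, Complex.norm_real, Real.norm_of_nonneg ha0.le]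
      have h3 := norm_sub_le (u : ℂ) z
      rw [Circle.norm_coe] at h3
      have h4 : a * ‖(u : ℂ) - z‖ ≤ a * (‖z‖ + ‖z‖) := by
        gcongr
        linarith
      linarith
    have h2 := (ha.continuation (convex_openCone u δ) hΦ he hzK hrad hvr huK h1).1
    have h3 := hR₁ a h2
    have h4 : a * R₁ ≤ a * ‖z‖ := by
      gcongr
      linarith
    linarith
  have hwn : ‖(z + (e y - e (Φ z)) / a : ℂ) - z‖ ≤ η * x := by
    rw [add_sub_cancel_left, norm_div, Complex.norm_real, Real.norm_of_nonneg ha0.le, norm_sub_rev,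
      div_le_iff₀ ha0]
    have h1 : r / 4 ≤ a * ((1 + δ / 2) * x) := haz.trans (by gcongr)
    have h2 : ε' * (r / 4) ≤ η * x * a * (r / 4) := by
      calc ε' * (r / 4) ≤ ε' * (a * ((1 + δ / 2) * x)) := by gcongr
        _ = ε' * (1 + δ / 2) * (a * x) := by ring
        _ ≤ η * (r / 4) * (a * x) := by gcongr
        _ = η * x * a * (r / 4) := by ring
    exact hzb.le.trans (le_of_mul_le_mul_right h2 (by positivity))
  have hwK : (z + (e y - e (Φ z)) / a : ℂ) ∈ openCone u (3 / 4 * δ) := by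
    refine mem_openCone_of_norm_sub_le (by positivity) hz hwn ?_
    rw [← hx]
    have h1 : (1 + 3 / 4 * δ) * η ≤ 3 / 4 * δ - δ / 2 := by nlinarith
    calc (1 + 3 / 4 * δ) * (η * x) = (1 + 3 / 4 * δ) * η * x := by ring
      _ ≤ _ := by gcongr
  have hwx : R < ((z + (e y - e (Φ z)) / a) * (starRingEnd ℂ) (u : ℂ)).re := by
    have h1 := (abs_re_mul_conj_le u _).trans hwn
    rw [sub_mul, Complex.sub_re, ← hx] at h1
    have h2 := (abs_le.1 h1).1
    have h3 := le_abs_self R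
    nlinarith
  have hwK' := openCone_mono (by positivity) (by linarith : 3 / 4 * δ ≤ δ) hwK
  have hAw : e (Φ z) + a * ((z + (e y - e (Φ z)) / a) - z) = e y := by
    field_simp
    ring
  obtain ⟨h1, h2⟩ := ha.continuation (convex_openCone u δ) hΦ he hzK hrad hvr hwK'
    (by rw [hAw]; exact Metric.mem_ball_self hr)
  exact ⟨_, hwK, hwx, e.injOn h1.2.1 hye (h2.trans hAw), a, h1⟩

/-- Immersions of arbitrarily large discs with the same germ at the center define an immersion of
the plane. -/
theorem exists_plane_immersion {w : ℕ → ℂ} {a : ℝ}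
    (hw : ∀ n, ∀ v ∈ Metric.ball (w n) n, S.ImmersedAt Φ v) (hwy : ∀ n, Φ (w n) = y)
    (ha : ∀ n, DilationAtlas.HasScaleAt Φ (w n) e a) : ∃ Ψ : ℂ → X, ∀ z, S.ImmersedAt Ψ z := by
  have him : ∀ n : ℕ, ∀ z ∈ Metric.ball (0 : ℂ) n, S.ImmersedAt (fun z => Φ (w n + z)) z := by
    intro n z hz
    have h1 : S.ImmersedAt Φ (((1 : ℝ) : ℂ) * z + w n) := by
      refine hw n _ ?_
      rw [mem_ball_zero_iff] at hz
      simpa [dist_eq_norm] using hz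
    have h2 := h1.comp_dilation one_pos
    simpa [add_comm] using h2
  have hgerm : ∀ n, ∀ᶠ z in 𝓝 (0 : ℂ), Φ (w n + z) = e.symm (e y + a * z) := by
    intro n
    have h1 : Tendsto (fun z => w n + z) (𝓝 0) (𝓝 (w n)) := by
      have h2 := (by fun_prop : Continuous fun z : ℂ => w n + z).tendsto 0
      rwa [add_zero] at h2
    filter_upwards [h1.eventually (ha n).2.2] with z hz
    have h3 : e (Φ (w n + z)) = e y + a * z := by
      rw [hz.2, hwy, add_sub_cancel_left]
    rw [← h3, e.left_inv hz.1]
  have hagree : ∀ n m : ℕ, ∀ z ∈ Metric.ball (0 : ℂ) n, z ∈ Metric.ball (0 : ℂ) m →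
      Φ (w n + z) = Φ (w m + z) := by
    intro n m z hzn hzm
    have h0 : (0 : ℂ) ∈ Metric.ball (0 : ℂ) n ∩ Metric.ball (0 : ℂ) m :=
      ⟨Metric.mem_ball_self (Metric.pos_of_mem_ball hzn),
        Metric.mem_ball_self (Metric.pos_of_mem_ball hzm)⟩
    refine (DilationAtlas.eqOn_of_eventuallyEq (S := S.toDilationAtlas) (Φ := fun z => Φ (w n + z))
      (Ψ := fun z => Φ (w m + z)) ((convex_ball (0 : ℂ) n).inter (convex_ball 0 m)).isPreconnected
      (fun z hz => him n z hz.1) (fun z hz => him m z hz.2) h0 ?_ z ⟨hzn, hzm⟩).eq_of_nhds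
    filter_upwards [hgerm n, hgerm m] with z h1 h2
    rw [h1, h2]
  have hmem : ∀ z : ℂ, z ∈ Metric.ball (0 : ℂ) (⌊‖z‖⌋₊ + 1 : ℕ) := fun z => by
    rw [mem_ball_zero_iff]
    exact_mod_cast Nat.lt_floor_add_one ‖z‖
  -- The index is an integer larger than `‖z‖`, so that `z` lies in the corresponding disc.
  refine ⟨fun z => Φ (w (⌊‖z‖⌋₊ + 1) + z), fun z => (him _ z (hmem z)).congr ?_⟩
  filter_upwards [Metric.isOpen_ball.mem_nhds (hmem z)] with v hv
  exact hagree _ _ v (hmem v) hv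

/-- If an infinite cone is immersed in `X`, then `X` contains a hyperbolic closed geodesic or is a
translation surface without singularities. -/
theorem exists_hyperbolic_or_isTranslation [CompactSpace X] [ConnectedSpace X] (hδ : 0 < δ)
    (hΦ : ∀ z ∈ openCone u δ, S.ImmersedAt Φ z) :
    (∃ (γ : ℝ → X) (d : Circle) (r : ℝ), 0 < r ∧ (r : ℂ) * d ∈ openCone u δ ∧
      S.IsHyperbolicClosedGeodesic γ d) ∨ S.IsTranslation ∧ S.sing = ∅ := by
  obtain ⟨y, e, he, hye, hw⟩ := exists_preimages_at_infinity hδ hΦ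
  have hsub : openCone u (3 / 4 * δ) ⊆ openCone u δ := openCone_mono (by positivity) (by linarith)
  obtain ⟨w₁, hw₁K, -, hw₁y, a₁, ha₁⟩ := hw 0
  by_cases hex : ∃ w ∈ openCone u δ, ∃ a, Φ w = y ∧ DilationAtlas.HasScaleAt Φ w e a ∧ a₁ ≠ a ∧
      w - w₁ ∈ openCone u δ
  · obtain ⟨w, hwK, a, hwy, ha, hne, hdir⟩ := hex
    obtain ⟨ρ, d, hρ, hρd⟩ := exists_eq_real_mul_circle (ne_zero_of_mem_openCone hdir)
    exact Or.inl ⟨_, d, ρ, hρ, hρd ▸ hdir, DilationAtlas.isHyperbolicClosedGeodesic_segment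
      (convex_openCone u δ) hΦ he (hsub hw₁K) hwK (hw₁y.trans hwy.symm) ha₁ ha hne hρ hρd⟩
  right
  have hfar : ∀ C : ℝ, ∃ R : ℝ, ∀ w ∈ openCone u (3 / 4 * δ),
      R < (w * (starRingEnd ℂ) (u : ℂ)).re → ∀ v, ‖v - w‖ ≤ C → v ∈ openCone u δ := by
    intro C
    refine ⟨(1 + δ) * C / (1 / 4 * δ), fun w hw hR v hv => ?_⟩
    refine mem_openCone_of_norm_sub_le hδ.le hw hv ?_
    rw [div_lt_iff₀ (by positivity)] at hR
    linarith
  have hn : ∀ n : ℕ, ∃ w, (∀ v ∈ Metric.ball w n, S.ImmersedAt Φ v) ∧ Φ w = y ∧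
      DilationAtlas.HasScaleAt Φ w e a₁ := by
    intro n
    -- Beyond `R` a displacement by `-w₁` keeps `w` in the cone, so the scale must equal `a₁`. The
    -- disc of radius `n` around `w` is in the cone as well.
    obtain ⟨R, hR⟩ := hfar (max n ‖w₁‖)
    obtain ⟨w, hwK, hwR, hwy, a, ha⟩ := hw R
    have hne : a₁ = a := by
      by_contra hne
      refine hex ⟨w, hsub hwK, a, hwy, ha, hne, hR w hwK hwR _ ?_⟩
      rw [sub_sub_cancel_left, norm_neg]
      exact le_max_right _ _
    refine ⟨w, fun v hv => hΦ v (hR w hwK hwR v ?_), hwy, hne ▸ ha⟩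
    rw [Metric.mem_ball, dist_eq_norm] at hv
    exact hv.le.trans (le_max_left _ _)
  choose w hw1 hw2 hw3 using hn
  obtain ⟨Ψ, hΨ⟩ := exists_plane_immersion hw1 hw2 hw3
  exact isTranslation_of_plane hΨ

end DilationSurface

/-! ### From arcs of directions to cones, and conclusion. -/

/-- An open arc contains the directions of a convex open cone. -/
theorem IsOpenArc.exists_openCone {U : Set Circle} (hU : IsOpenArc U) :
    ∃ (u : Circle) (δ : ℝ), 0 < δ ∧ ∀ z ∈ openCone u δ, ∃ r : ℝ, 0 < r ∧ ∃ d ∈ U, z = (r : ℂ) * d := by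
  obtain ⟨a, b, hab, -, rfl⟩ := hU
  set m := (a + b) / 2 with hm
  set O : Set ℂ := {z | ∃ r : ℝ, 0 < r ∧ ∃ d ∈ Circle.exp '' Ioo a b, z = (r : ℂ) * d} with hO
  have hnhds : O ∈ 𝓝 (Circle.exp m : ℂ) := by
    have h1 : {ω : ℂ | ω.im ∈ Ioo a b} ∈ 𝓝 ((m : ℂ) * Complex.I) := by
      refine (isOpen_Ioo.preimage Complex.continuous_im).mem_nhds ?_
      show ((m : ℂ) * Complex.I).im ∈ Ioo a b
      simp only [Complex.im_ofReal_mul, Complex.I_im, mul_one]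
      exact ⟨by linarith, by linarith⟩
    -- The exponential is open and maps the horizontal strip `a < im < b` into the sector, which is
    -- therefore a neighbourhood of its middle direction.
    have h2 := (Complex.hasStrictDerivAt_exp ((m : ℂ) * Complex.I)).map_nhds_eq
      (Complex.exp_ne_zero _)
    rw [Circle.coe_exp, ← h2]
    refine mem_of_superset (image_mem_map h1) ?_
    rintro _ ⟨ω, hω, rfl⟩
    refine ⟨Real.exp ω.re, Real.exp_pos _, Circle.exp ω.im, ⟨ω.im, hω, rfl⟩, ?_⟩
    rw [Circle.coe_exp, Complex.ofReal_exp, ← Complex.exp_add, Complex.re_add_im]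
  obtain ⟨δ, hδ, h⟩ := exists_openCone_subset hnhds (by
    rintro t _ ht ⟨r, hr, d, hd, rfl⟩
    exact ⟨t * r, mul_pos ht hr, d, hd, by push_cast; ring⟩)
  exact ⟨Circle.exp m, δ, hδ, fun z hz => h z (re_pos_of_mem_openCone hδ hz) (mem_openCone.1 hz).le⟩

theorem mainTheorem7 {X : Type*} [TopologicalSpace X] [CompactSpace X] [T2Space X]
    [ConnectedSpace X] (S : DilationSurface X) (hS : S.IsTranslation → S.sing.Nonempty)
    (x₀ : X) (U : Set Circle) (hU : IsOpenArc U) (φ : ℂ → X) (hφ : S.IsPencil x₀ U φ)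
    (hit : ∀ u ∈ U, ∀ y : X, S.TrajectoryReaches x₀ φ u y → y ∉ S.sing ∧ y ∉ S.boundary) :
    ∃ (γ : ℝ → X) (d : Circle), S.IsHyperbolicClosedGeodesic γ d ∧ (d ∈ U ∨ -d ∈ U) := by
  obtain ⟨u, δ, hδ, hcone⟩ := hU.exists_openCone
  have hdir : ∀ (r : ℝ) (d : Circle), 0 < r → (r : ℂ) * d ∈ openCone u δ → d ∈ U := by
    intro r d hr h
    obtain ⟨r', hr', d', hd', heq⟩ := hcone _ h
    have hn := congrArg norm heq
    rw [norm_mul, norm_mul, Circle.norm_coe, Circle.norm_coe, Complex.norm_real, Complex.norm_real,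
      Real.norm_of_nonneg hr.le, Real.norm_of_nonneg hr'.le, mul_one, mul_one] at hn
    rw [← hn] at heq
    have hdd : d = d' := Circle.ext (mul_left_cancel₀ (by exact_mod_cast hr.ne') heq)
    rwa [hdd]
  obtain ⟨ε, hε, htend, himm⟩ := hφ
  have hsub : coneSector u δ ε ⊆ planarSector U ε := by
    rintro z ⟨hzK, hzb⟩
    obtain ⟨r, hr, d, hd, rfl⟩ := hcone z hzK
    refine ⟨r, ⟨hr, ?_⟩, d, hd, rfl⟩
    rwa [mem_ball_zero_iff, norm_mul, Circle.norm_coe, Complex.norm_real, Real.norm_of_nonneg hr.le,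
      mul_one] at hzb
  have hp : S.IsConePencil x₀ φ u δ ε := ⟨hδ, hε, htend.mono_left (nhdsWithin_mono _ hsub),
    fun z hz => by
      obtain ⟨e, he, hz', c, hc, hev⟩ := himm z (hsub hz)
      exact ⟨e, he, c, hc, hz', hev⟩⟩
  have hfin : (∃ (γ : ℝ → X) (d : Circle) (r : ℝ), 0 < r ∧ (r : ℂ) * d ∈ openCone u δ ∧
      S.IsHyperbolicClosedGeodesic γ d) := by
    by_cases hall : ∀ z ∈ openCone u δ, z ∈ S.domain φ u δ ε
    · refine (DilationSurface.exists_hyperbolic_or_isTranslation hδ fun z hz =>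
        hp.immersed_extension (hall z hz)).resolve_right ?_
      rintro ⟨h1, h2⟩
      exact (hS h1).ne_empty h2
    · push Not at hall
      obtain ⟨z₁, hz₁, hz₁D⟩ := hall
      refine hp.exists_hyperbolic_of_notMem (fun d hd => hit d (hdir 1 d one_pos ?_)) hz₁ hz₁D
      simpa using hd
  obtain ⟨γ, d, r, hr, hrd, hγ⟩ := hfin
  exact ⟨γ, d, hγ, Or.inl (hdir r d hr hrd)⟩

end
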